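/- Let $G$ be a second countable, locally compact, unimodular group with Haar measure $\mu_G$. Let $\pi : G \to \mathcal{U}(\mathcal{H}_\pi)$ be a projective unitary representation on a separable complex Hilbert space (strongly measurable, with $\pi(x)\pi(y) = \sigma(x,y)\,\pi(xy)$ for some $\sigma : G \times G \to \mathbb{T}$) that is a discrete series representation, i.e. irreducible with $\int_G |\langle h, \pi(x) h\rangle|^2 \, d\mu_G(x) < \infty$ for some $h \neq 0$. Then there is a unique $d_\pi > 0$, the formal degree of $\pi$, such that \[ \int_G \langle f_1, \pi(x) g_1\rangle \langle \pi(x) g_2, f_2\rangle \, d\mu_G(x) = d_\pi^{-1} \langle f_1, f_2\rangle \overline{\langle g_1, g_2\rangle} \qquad (f_1,f_2,g_1,g_2 \in \mathcal{H}_\pi), \] with absolutely convergent integrals. For $g \in \mathcal{H}_\pi$ write $V_g g(x) = \langle g, \pi(x) g\rangle$ and, for a relatively compact symmetric neighbourhood $Q$ of the unit $e$, $M_Q V_g g(x) = \sup_{q \in Q} |V_g g(xq)|$. Let $\mathcal{D}_\pi$ be the set of $g$ with $M_{Q} V_g g \in L^2(G)$ for some (equivalently, every) such $Q$. The system $\pi(\Lambda)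 g$, with $\Lambda \subseteq G$, is a frame with bounds $A, B > 0$ if $A\|f\|^2 \le \sum_{\lambda \in \Lambda} |\langle f, \pi(\lambda) g\rangle|^2 \le B \|f\|^2$ for all $f \in \mathcal{H}_\pi$. A strong F\o lner exhaustion sequence is a sequence $(K_n)_{n \in \mathbb{N}}$ of compact sets of positive measure such that $\mu_G(K_n K \cap K_n^c K)/\mu_G(K_n) \to 0$ for every compact $K \subseteq G$, $e \in K_n \subseteq (K_{n+1})^\circ$ for all $n$, and $\bigcup_n K_n = G$. Let $g \in \mathcal{D}_\pi$, let $Q$ be a relatively compact symmetric unit neighbourhood, and let $A, B > 0$. There is a constant $C > 0$, depending (for the given $G$, $\mu_G$ and $\pi$) only on $g$, $Q$, $A$ and $B$, such that, for every $\Lambda \subseteq G$ for which $\pi(\Lambda) g$ is a frame for $\mathcal{H}_\pi$ with bounds $A, B$ and for every strong F\o lner exhaustion sequence $(K_n)_{n\in\mathbb{N}}$ in $G$, all the numbers $\#(\Lambda \cap xK_n)$ are finite and \[ \inf_{x \in G} \#(\Lambda \cap x K_n) \ge d_\pi \big( \mu_G(K_n) - C I_n \big), \qquad n \in \mathbb{N},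 \] where \[ I_n := \int_{K_n} \int_{K_n^c Q} |M_Q V_g g(y^{-1} z)|^2 \, d\mu_G(z)\, d\mu_G(y) < \infty \qquad\text{and}\qquad I_n = o\big(\mu_G(K_n)\big) \quad (n \to \infty). \] -/

import Mathlib

open MeasureTheory Filter Asymptotics
open scoped Topology ENNReal Pointwise

/-- A projective unitary representation of `G` on `H`: a strongly measurable map into the unitary
operators that is multiplicative up to a `𝕋`-valued cocycle. -/
structure ProjectiveRep (G H : Type*) [Group G] [TopologicalSpace G] [MeasurableSpace G]
    [NormedAddCommGroup H] [InnerProductSpace ℂ H] where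
  /-- the unitary operators `π(x)` -/
  op : G → (H ≃ₗᵢ[ℂ] H)
  /-- the cocycle `σ` -/
  cocycle : G → G → Circle
  op_op : ∀ x y f, op x (op y f) = (cocycle x y : ℂ) • op (x * y) f
  stronglyMeasurable_op : ∀ f, StronglyMeasurable fun x => op x f

namespace ProjectiveRep

variable {G H : Type*} [Group G] [TopologicalSpace G] [MeasurableSpace G]
  [NormedAddCommGroup H] [InnerProductSpace ℂ H]

/-- The only closed invariant subspaces are `0` and `H`. -/
def IsIrreducible (π : ProjectiveRep G H) : Prop :=
  ∀ W : Submodule ℂ H, IsClosed (W : Set H) → (∀ x, ∀ f ∈ W, π.op x f ∈ W) → W = ⊥ ∨ W = ⊤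

/-- The coefficient transform `V_g f (x) = ⟨f, π(x) g⟩`. The inner product of the source is linear
in its first argument, whereas `inner ℂ` is linear in its second one. -/
noncomputable def coeff (π : ProjectiveRep G H) (g f : H) (x : G) : ℂ :=
  inner ℂ (π.op x g) f

/-- Irreducible, with some nonzero `g` such that `∫ |⟨g, π(x) g⟩|² dμ(x) < ∞`. -/
def IsDiscreteSeries (π : ProjectiveRep G H) (μ : Measure G) : Prop :=
  π.IsIrreducible ∧ ∃ g : H, g ≠ 0 ∧ ∫⁻ x, ‖π.coeff g g x‖ₑ ^ 2 ∂μ < ∞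

/-- `d > 0` satisfies the orthogonality relations
`∫ ⟨f₁, π(x) g₁⟩ ⟨π(x) g₂, f₂⟩ dμ(x) = d⁻¹ ⟨f₁, f₂⟩ conj ⟨g₁, g₂⟩`
(inner products linear in the first argument), the integrals being absolutely convergent. -/
def IsFormalDegree (π : ProjectiveRep G H) (μ : Measure G) (d : ℝ) : Prop :=
  0 < d ∧ ∀ f₁ f₂ g₁ g₂ : H,
    Integrable (fun x => π.coeff g₁ f₁ x * starRingEnd ℂ (π.coeff g₂ f₂ x)) μ ∧
    ∫ x, π.coeff g₁ f₁ x * starRingEnd ℂ (π.coeff g₂ f₂ x) ∂μ =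
      (d : ℂ)⁻¹ * inner ℂ f₂ f₁ * starRingEnd ℂ (inner ℂ g₂ g₁)

/-- The family `(π(λ) g)_{λ ∈ Λ}`, indexed by `Λ`, is a frame with frame bounds `A` and `B`. -/
def IsFrameWithBounds (π : ProjectiveRep G H) (Λ : Set G) (g : H) (A B : ℝ) : Prop :=
  0 < A ∧ 0 < B ∧ ∀ f : H,
    ENNReal.ofReal (A * ‖f‖ ^ 2) ≤ ∑' l : Λ, ‖π.coeff g f l‖ₑ ^ 2 ∧
    ∑' l : Λ, ‖π.coeff g f l‖ₑ ^ 2 ≤ ENNReal.ofReal (B * ‖f‖ ^ 2)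

end ProjectiveRep

/-- `Q` is a relatively compact symmetric neighbourhood of the unit. -/
def IsRelCompactSymmUnitNhd {G : Type*} [Group G] [TopologicalSpace G] (Q : Set G) : Prop :=
  Q ∈ 𝓝 (1 : G) ∧ Q⁻¹ = Q ∧ IsCompact (closure Q)

/-- The local maximal function `M_Q F (x) = sup_{z ∈ Q} |F (x z)|`, with values in `[0, ∞]`. -/
noncomputable def localMax {G : Type*} [Group G] (Q : Set G) (F : G → ℂ) (x : G) : ℝ≥0∞ :=
  ⨆ z ∈ Q, ‖F (x * z)‖ₑ

/-- The set `𝒟_π` of vectors `g` with `M_Q V_g g ∈ L²`. The condition does not depend on the choice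
of `Q`; the definition asks for it for one `Q`. -/
def ProjectiveRep.localizedVectors {G H : Type*} [Group G] [TopologicalSpace G] [MeasurableSpace G]
    [NormedAddCommGroup H] [InnerProductSpace ℂ H] (π : ProjectiveRep G H) (μ : Measure G) :
    Set H :=
  {g | ∃ Q : Set G, IsRelCompactSymmUnitNhd Q ∧ ∫⁻ x, localMax Q (π.coeff g g) x ^ 2 ∂μ < ∞}

/-- A (right) strong Følner sequence. -/
structure IsStrongFolner {G : Type*} [Group G] [TopologicalSpace G] [MeasurableSpace G]
    (μ : Measure G) (K : ℕ → Set G) : Prop where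
  isCompact : ∀ n, IsCompact (K n)
  nonnull : ∀ n, μ (K n) ≠ 0
  tendsto : ∀ L : Set G, IsCompact L →
    Tendsto (fun n => μ ((K n * L) ∩ ((K n)ᶜ * L)) / μ (K n)) atTop (𝓝 0)

/-- A strong Følner exhaustion sequence. -/
structure IsStrongFolnerExhaustion {G : Type*} [Group G] [TopologicalSpace G] [MeasurableSpace G]
    (μ : Measure G) (K : ℕ → Set G) : Prop extends IsStrongFolner μ K where
  one_mem : ∀ n, (1 : G) ∈ K n
  subset_interior : ∀ n, K n ⊆ interior (K (n + 1))
  iUnion_eq : ⋃ n, K n = Set.univ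

/-- The error term `∫_K ∫_{Kᶜ Q} |M_Q V_g g (y⁻¹ z)|² dμ(z) dμ(y)`. -/
noncomputable def ProjectiveRep.errorTerm {G H : Type*} [Group G] [TopologicalSpace G]
    [MeasurableSpace G] [NormedAddCommGroup H] [InnerProductSpace ℂ H] (π : ProjectiveRep G H)
    (μ : Measure G) (Q : Set G) (g : H) (K : Set G) : ℝ≥0∞ :=
  ∫⁻ y in K, ∫⁻ z in Kᶜ * Q, localMax Q (π.coeff g g) (y⁻¹ * z) ^ 2 ∂μ ∂μ

/-! The proof compares the dimension of a space with the measure of `K`. The canonical dual frame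
vectors with index in `Λ ∩ K` span a space `V` with `dim V ≤ #(Λ ∩ K)`. Dropping the other frame
coefficients of `π(y) g` shows that its squared distance to `V` is at most `A⁻¹ ∑_{λ ∉ K} |V_g g(y⁻¹
λ)|²`. Pythagoras bounds `‖g‖²` by `‖P_V π(y) g‖²` plus this quantity. Over `y ∈ K`, the projection
term integrates to at most `dim V · d⁻¹ ‖g‖²` by the orthogonality relations
(`measure_mul_norm_sq_le`).

The sum over `λ ∉ K` is at most a constant times an integral of `M_Q V_g g` squared over `Kᶜ Q`
(`measure_interior_mul_tsum_le`), because the upper frame bound limits the number of points of `Λ`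
in any translate of `Q`, uniformly in `Λ` (`exists_encard_inter_smul_le`). Since `x⁻¹ Λ` gives a
frame with the same bounds, the estimate is uniform in `x`.

The orthogonality relations come from Schur's lemma applied on the graph of `f ↦ V_g f`, and the
Følner condition gives `I_n = o(μ(K_n))`. -/

namespace ProjectiveRep

/-! ### Phase calculus for projective representations -/

section Algebra

variable {G H : Type*} [Group G] [TopologicalSpace G] [MeasurableSpace G]
  [NormedAddCommGroup H] [InnerProductSpace ℂ H] (π : ProjectiveRep G H)

lemma exists_op_mul (x y : G) :
    ∃ c : ℂ, ‖c‖ = 1 ∧ ∀ f, π.op (x * y) f = c • π.op x (π.op y f) := by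
  refine ⟨((π.cocycle x y)⁻¹ : Circle), Circle.norm_coe _, fun f => ?_⟩
  rw [π.op_op, smul_smul, ← Circle.coe_mul, inv_mul_cancel, Circle.coe_one, one_smul]

lemma op_one (f : H) : π.op 1 f = (π.cocycle 1 1 : ℂ) • f := by
  have h := π.op_op 1 1 f
  rw [one_mul, ← map_smul] at h
  exact (π.op 1).injective h

lemma exists_symm_op (x : G) :
    ∃ c : ℂ, ‖c‖ = 1 ∧ ∀ f, (π.op x).symm f = c • π.op x⁻¹ f := by
  obtain ⟨c, hc, h⟩ := π.exists_op_mul x x⁻¹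
  have hc0 : c ≠ 0 := by rintro rfl; simp at hc
  refine ⟨(π.cocycle 1 1 : ℂ)⁻¹ * c, by simp [hc, Circle.norm_coe], fun f => ?_⟩
  apply (π.op x).injective
  have h1 := h f
  rw [mul_inv_cancel, op_one] at h1
  rw [LinearIsometryEquiv.apply_symm_apply, map_smul, mul_smul, ← h1, smul_smul,
    inv_mul_cancel₀ (Circle.coe_ne_zero _), one_smul]

/-- The constant does not depend on the vectors, so it cancels in products of a coefficient with the
conjugate of another. -/
lemma exists_coeff_mul_left (x y : G) :
    ∃ c : ℂ, ‖c‖ = 1 ∧ ∀ g f, π.coeff g f (x * y) = c * π.coeff g ((π.op x).symm f) y := by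
  obtain ⟨c, hc, h⟩ := π.exists_op_mul x y
  refine ⟨starRingEnd ℂ c, by simpa using hc, fun g f => ?_⟩
  rw [coeff, h, inner_smul_left, coeff, LinearIsometryEquiv.inner_map_eq_flip]

lemma exists_coeff_inv (x : G) :
    ∃ c : ℂ, ‖c‖ = 1 ∧ ∀ g f, π.coeff g f x = c * starRingEnd ℂ (π.coeff f g x⁻¹) := by
  obtain ⟨c, hc, h⟩ := π.exists_symm_op x
  refine ⟨c, hc, fun g f => ?_⟩
  rw [coeff, coeff, LinearIsometryEquiv.inner_map_eq_flip, h, inner_smul_right, inner_conj_symm]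

lemma norm_coeff_mul_left (g f : H) (x y : G) :
    ‖π.coeff g f (x * y)‖ = ‖π.coeff g ((π.op x).symm f) y‖ := by
  obtain ⟨c, hc, h⟩ := π.exists_coeff_mul_left x y
  rw [h, norm_mul, hc, one_mul]

lemma norm_coeff_op_left (g f : H) (x y : G) :
    ‖π.coeff g (π.op x f) y‖ = ‖π.coeff g f (x⁻¹ * y)‖ := by
  have := π.norm_coeff_mul_left g (π.op x f) x (x⁻¹ * y)
  rwa [mul_inv_cancel_left, LinearIsometryEquiv.symm_apply_apply] at this

lemma norm_coeff_mul_right (g f : H) (x y : G) :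
    ‖π.coeff g f (x * y)‖ = ‖π.coeff (π.op y g) f x‖ := by
  obtain ⟨c, hc, h⟩ := π.exists_op_mul x y
  rw [coeff, h, inner_smul_left, norm_mul, RCLike.norm_conj, hc, one_mul, coeff]

lemma norm_coeff_inv (g f : H) (x : G) : ‖π.coeff g f x⁻¹‖ = ‖π.coeff f g x‖ := by
  obtain ⟨c, hc, h⟩ := π.exists_coeff_inv x
  rw [h, norm_mul, hc, one_mul, RCLike.norm_conj]

lemma norm_coeff_self_one (g : H) : ‖π.coeff g g 1‖ = ‖g‖ ^ 2 := by
  rw [coeff, op_one, inner_smul_left, norm_mul, RCLike.norm_conj, Circle.norm_coe, one_mul,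
    inner_self_eq_norm_sq_to_K]
  simp

lemma coeff_add_right (g f f' : H) (x : G) :
    π.coeff g (f + f') x = π.coeff g f x + π.coeff g f' x := inner_add_right _ _ _

lemma coeff_smul_right (g f : H) (c : ℂ) (x : G) :
    π.coeff g (c • f) x = c * π.coeff g f x := inner_smul_right _ _ _

lemma coeff_add_left (g g' f : H) (x : G) :
    π.coeff (g + g') f x = π.coeff g f x + π.coeff g' f x := by
  simp [coeff]

lemma coeff_smul_left (g f : H) (c : ℂ) (x : G) :
    π.coeff (c • g) f x = starRingEnd ℂ c * π.coeff g f x := by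
  simp [coeff, mul_comm]

lemma stronglyMeasurable_coeff (g f : H) : StronglyMeasurable (π.coeff g f) :=
  (π.stronglyMeasurable_op g).inner stronglyMeasurable_const

end Algebra

/-! ### Continuity of the modulus of the coefficients -/

section Continuity

variable {G H : Type*} [Group G] [TopologicalSpace G] [IsTopologicalGroup G]
  [LocallyCompactSpace G] [SecondCountableTopology G] [T2Space G] [MeasurableSpace G]
  [BorelSpace G] [NormedAddCommGroup H] [InnerProductSpace ℂ H]
  [TopologicalSpace.SeparableSpace H] (π : ProjectiveRep G H)

/-- Near the unit, `π(x) f` is close to the line spanned by `f`. -/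
lemma eventually_exists_norm_op_sub_le (f : H) {ε : ℝ} (hε : 0 < ε) :
    ∀ᶠ x in 𝓝 (1 : G), ∃ c : ℂ, ‖c‖ = 1 ∧ ‖π.op x f - c • f‖ ≤ ε := by
  borelize H
  let μ : Measure G := Measure.haar
  -- By separability countably many such sets cover `G`, so one has positive Haar measure and its
  -- difference set is a neighbourhood of the unit (Steinhaus). Inverses are used because `π(x)
  -- π(x⁻¹) f` is a multiple of `f`.
  let E : ℕ → Set G := fun k =>
    (fun x => π.op x⁻¹ f) ⁻¹' Metric.ball (TopologicalSpace.denseSeq H k) (ε / 2)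
  have hm : Measurable fun x : G => π.op x⁻¹ f :=
    (π.stronglyMeasurable_op f).measurable.comp measurable_inv
  have hcov : ⋃ k, E k = Set.univ := by
    refine Set.eq_univ_of_forall fun x => Set.mem_iUnion.2 ?_
    obtain ⟨k, hk⟩ := (TopologicalSpace.denseRange_denseSeq H).exists_dist_lt (π.op x⁻¹ f)
      (half_pos hε)
    exact ⟨k, hk⟩
  obtain ⟨k, hk⟩ : ∃ k, μ (E k) ≠ 0 := by
    by_contra! h
    have : μ Set.univ = 0 := hcov ▸ measure_iUnion_null h
    exact (NeZero.ne μ) (Measure.measure_univ_eq_zero.1 this)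
  have hE : E k / E k ∈ 𝓝 (1 : G) :=
    Measure.div_mem_nhds_one_of_haar_pos μ _ (hm Metric.isOpen_ball.measurableSet)
      (pos_iff_ne_zero.2 hk)
  filter_upwards [hE] with z hz
  obtain ⟨x, hx, y, hy, rfl⟩ := Set.mem_div.1 hz
  obtain ⟨c, hc, h⟩ := π.exists_op_mul x y⁻¹
  obtain ⟨c', hc', h'⟩ := π.exists_symm_op x⁻¹
  refine ⟨c * c'⁻¹, by simp [hc, hc'], ?_⟩
  have hc0 : c' ≠ 0 := by rintro rfl; simp at hc'
  have h1 : π.op x (π.op x⁻¹ f) = c'⁻¹ • f := by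
    have := h' (π.op x⁻¹ f)
    rw [LinearIsometryEquiv.symm_apply_apply, inv_inv] at this
    rw [eq_inv_smul_iff₀ hc0, ← this]
  have hd : dist (π.op y⁻¹ f) (π.op x⁻¹ f) ≤ ε := by
    have h2 := dist_triangle_right (π.op y⁻¹ f) (π.op x⁻¹ f) (TopologicalSpace.denseSeq H k)
    have h3 : dist (π.op x⁻¹ f) _ < ε / 2 := hx
    have h4 : dist (π.op y⁻¹ f) _ < ε / 2 := hy
    linarith
  rw [div_eq_mul_inv, h, mul_smul, ← h1, ← smul_sub, norm_smul, hc, one_mul, ← map_sub,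
    LinearIsometryEquiv.norm_map, ← dist_eq_norm]
  exact hd

/-- Only the modulus can be continuous in general, since the phases of `π` are merely measurable. -/
theorem continuous_norm_coeff (g f : H) : Continuous fun x => ‖π.coeff g f x‖ := by
  refine continuous_iff_continuousAt.2 fun x => ?_
  rw [ContinuousAt, Metric.tendsto_nhds]
  intro ε hε
  have hδ : 0 < ε / (‖f‖ + 1) := by positivity
  have hev := π.eventually_exists_norm_op_sub_le g hδ
  have ht : Tendsto (fun y => x⁻¹ * y) (𝓝 x) (𝓝 1) := by
    have : Continuous fun y => x⁻¹ * y := by fun_prop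
    simpa using this.tendsto x
  filter_upwards [ht.eventually hev] with y hy
  obtain ⟨c, hc, h⟩ := hy
  have h1 : ‖π.coeff g f y‖ = ‖inner ℂ (π.op x (π.op (x⁻¹ * y) g)) f‖ := by
    have := π.norm_coeff_mul_right g f x (x⁻¹ * y)
    rwa [mul_inv_cancel_left] at this
  have h2 : ‖π.coeff g f x‖ = ‖inner ℂ (π.op x (c • g)) f‖ := by
    rw [map_smul, inner_smul_left, norm_mul, RCLike.norm_conj, hc, one_mul, coeff]
  rw [h1, h2, Real.dist_eq]
  calc |_| ≤ ‖inner ℂ (π.op x (π.op (x⁻¹ * y) g)) f - inner ℂ (π.op x (c • g)) f‖ :=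
        abs_norm_sub_norm_le _ _
    _ = ‖inner ℂ (π.op x (π.op (x⁻¹ * y) g - c • g)) f‖ := by rw [map_sub, inner_sub_left]
    _ ≤ ‖π.op x (π.op (x⁻¹ * y) g - c • g)‖ * ‖f‖ := norm_inner_le_norm _ _
    _ ≤ ε / (‖f‖ + 1) * ‖f‖ := by
        rw [LinearIsometryEquiv.norm_map]; gcongr
    _ < ε / (‖f‖ + 1) * (‖f‖ + 1) := by gcongr; linarith
    _ = ε := by field_simp

lemma continuous_enorm_coeff (g f : H) : Continuous fun x => ‖π.coeff g f x‖ₑ := by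
  have := ENNReal.continuous_ofReal.comp (π.continuous_norm_coeff g f)
  simpa only [Function.comp_def, ofReal_norm] using this

end Continuity

end ProjectiveRep

/-- A Haar measure that is also right invariant is invariant under inversion. -/
theorem MeasureTheory.Measure.IsHaarMeasure.isInvInvariant_of_isMulRightInvariant
    {G : Type*} [Group G] [TopologicalSpace G] [IsTopologicalGroup G] [LocallyCompactSpace G]
    [SecondCountableTopology G] [MeasurableSpace G] [BorelSpace G]
    (μ : Measure G) [μ.IsHaarMeasure] [μ.IsMulRightInvariant] : μ.IsInvInvariant := by
  have hH : μ.inv.IsHaarMeasure :=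
    { toIsFiniteMeasureOnCompacts := inferInstance
      toIsMulLeftInvariant := inferInstance
      toIsOpenPosMeasure := (Homeomorph.inv G).continuous.isOpenPosMeasure_map
        (Homeomorph.inv G).surjective }
  obtain ⟨k, hk, hk1⟩ := exists_compact_mem_nhds (1 : G)
  have heq : μ.inv = Measure.haarScalarFactor μ.inv μ • μ :=
    Measure.isMulLeftInvariant_eq_smul μ.inv μ
  set c := Measure.haarScalarFactor μ.inv μ
  -- A symmetric set has the same measure under `μ` and `μ.inv`; positive finite measure then forces
  -- `c = 1`.
  have hUo : IsOpen (interior k ∩ (interior k)⁻¹) := isOpen_interior.inter isOpen_interior.inv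
  have h1 : (1 : G) ∈ interior k ∩ (interior k)⁻¹ := by
    have := mem_interior_iff_mem_nhds.2 hk1
    simpa using this
  have hpos : μ (interior k ∩ (interior k)⁻¹) ≠ 0 := hUo.measure_ne_zero μ ⟨1, h1⟩
  have hfin : μ (interior k ∩ (interior k)⁻¹) ≠ ∞ :=
    ((measure_mono (Set.inter_subset_left.trans interior_subset)).trans_lt
      hk.measure_lt_top).ne
  have h2 : μ.inv (interior k ∩ (interior k)⁻¹) = c • μ (interior k ∩ (interior k)⁻¹) := by
    conv_lhs => rw [heq]
    rfl
  rw [Measure.inv_apply, Set.inter_inv, inv_inv, Set.inter_comm] at h2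
  have hc1 : (c : ℝ≥0∞) = 1 := by
    have h3 : (c : ℝ≥0∞) * μ (interior k ∩ (interior k)⁻¹) =
        1 * μ (interior k ∩ (interior k)⁻¹) := by
      rw [one_mul]; exact h2.symm
    exact (ENNReal.mul_left_inj hpos hfin).1 h3
  have hc1' : c = 1 := by exact_mod_cast hc1
  refine ⟨?_⟩
  rw [heq, hc1', one_smul]

namespace ProjectiveRep

/-! ### Schur's lemma -/

section Schur

variable {G H : Type*} [Group G] [TopologicalSpace G] [MeasurableSpace G]
  [NormedAddCommGroup H] [InnerProductSpace ℂ H] [CompleteSpace H] {π : ProjectiveRep G H}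

/-- **Schur's lemma** for self-adjoint operators. -/
theorem IsIrreducible.exists_eq_smul_of_commute (hπ : π.IsIrreducible) {T : H →L[ℂ] H}
    (hT : IsSelfAdjoint T) (hcomm : ∀ x f, T (π.op x f) = π.op x (T f)) :
    ∃ r : ℝ, ∀ f, T f = r • f := by
  -- The kernel of `φ(T)` is closed and invariant, so `φ(T)` is zero or injective.
  have hker : ∀ φ : ℝ → ℝ, cfc φ T = 0 ∨ ∀ f, cfc φ T f = 0 → f = 0 := by
    intro φ
    have hc : ∀ x f, cfc φ T (π.op x f) = π.op x (cfc φ T f) := by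
      intro x f
      have h : Commute T ((π.op x).toContinuousLinearEquiv : H →L[ℂ] H) := by
        ext f
        exact hcomm x f
      exact DFunLike.congr_fun (h.cfc_real φ).eq f
    rcases hπ (LinearMap.ker (cfc φ T).toLinearMap) (cfc φ T).isClosed_ker
      (fun x f hf => by
        have hf' : cfc φ T f = 0 := hf
        change cfc φ T (π.op x f) = 0
        rw [hc, hf', map_zero]) with h | h
    · right
      intro f hf
      have : f ∈ LinearMap.ker (cfc φ T).toLinearMap := hf
      rwa [h, Submodule.mem_bot] at this
    · left
      ext f
      have : f ∈ LinearMap.ker (cfc φ T).toLinearMap := h ▸ Submodule.mem_top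
      exact this
  have hsub : (spectrum ℝ T).Subsingleton := by
    intro a ha b hb
    by_contra hab
    wlog hlt : a < b generalizing a b
    · exact this hb ha (Ne.symm hab) (lt_of_le_of_ne (not_lt.1 hlt) (Ne.symm hab))
    -- Two spectral points would give nonzero operators `φ(T)`, `ψ(T)` with product zero, against
    -- injectivity.
    let m := (a + b) / 2
    let φ : ℝ → ℝ := fun t => max (m - t) 0
    let ψ : ℝ → ℝ := fun t => max (t - m) 0
    have hφc : Continuous φ := by fun_prop
    have hψc : Continuous ψ := by fun_prop
    have hprod : cfc φ T * cfc ψ T = 0 := by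
      rw [← cfc_mul φ ψ T hφc.continuousOn hψc.continuousOn]
      have : (fun t => φ t * ψ t) = fun _ => 0 := by
        funext t
        rcases le_total t m with h | h
        · simp [ψ, h]
        · simp [φ, h]
      rw [this, cfc_const_zero]
    have hne : ∀ χ : ℝ → ℝ, Continuous χ → ∀ t ∈ spectrum ℝ T, χ t ≠ 0 → cfc χ T ≠ 0 := by
      intro χ hχ t ht h0 h
      have h1 := cfc_map_spectrum (R := ℝ) χ T hT hχ.continuousOn
      have h2 : χ t ∈ spectrum ℝ (cfc χ T) := h1 ▸ Set.mem_image_of_mem _ ht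
      rw [h] at h2
      have hnt : Nontrivial (H →L[ℂ] H) := by
        by_contra hn
        rw [not_nontrivial_iff_subsingleton] at hn
        rw [spectrum.of_subsingleton] at ht
        exact ht
      rw [spectrum.zero_eq] at h2
      exact h0 h2
    have hφ0 : cfc φ T ≠ 0 := hne φ hφc a ha (by
      have : 0 < m - a := by simp only [m]; linarith
      simp [φ, this.le, this.ne'])
    have hψ0 : cfc ψ T ≠ 0 := hne ψ hψc b hb (by
      have : 0 < b - m := by simp only [m]; linarith
      simp [ψ, this.le, this.ne'])
    have hinj := (hker φ).resolve_left hφ0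
    apply hψ0
    ext f
    exact hinj _ (DFunLike.congr_fun hprod f)
  rcases hsub.eq_empty_or_singleton with h | ⟨r, h⟩
  · refine ⟨0, fun f => ?_⟩
    rw [CFC.eq_algebraMap_of_spectrum_subset_singleton T (0 : ℝ) (by simp [h]) hT]
    simp
  · refine ⟨r, fun f => ?_⟩
    conv_lhs => rw [CFC.eq_algebraMap_of_spectrum_subset_singleton T r h.subset hT]
    simp [Algebra.algebraMap_eq_smul_one]

end Schur

/-! ### The graph of the coefficient transform -/

section Graph

variable {G H : Type*} [Group G] [TopologicalSpace G] [MeasurableSpace G]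
  [NormedAddCommGroup H] [InnerProductSpace ℂ H] (π : ProjectiveRep G H) (μ : Measure G)

/-- The graph of the coefficient transform `f ↦ V_g f`, as a partially defined operator from `H`
to `L²`. -/
noncomputable def coeffGraph (g : H) : Submodule ℂ (WithLp 2 (H × Lp ℂ 2 μ)) where
  carrier := {p | p.snd =ᵐ[μ] π.coeff g p.fst}
  add_mem' := by
    intro p q hp hq
    filter_upwards [hp, hq, Lp.coeFn_add p.snd q.snd] with x h1 h2 h3
    rw [WithLp.add_snd, h3, Pi.add_apply, h1, h2, WithLp.add_fst, coeff_add_right]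
  zero_mem' := by
    filter_upwards [Lp.coeFn_zero ℂ 2 μ] with x h
    rw [WithLp.zero_snd, WithLp.zero_fst]
    exact h.trans (by simp [coeff])
  smul_mem' := by
    intro c p hp
    filter_upwards [hp, Lp.coeFn_smul c p.snd] with x h1 h2
    rw [WithLp.smul_snd, h2, Pi.smul_apply, h1, WithLp.smul_fst, coeff_smul_right, smul_eq_mul]

variable {π μ} in
lemma mem_coeffGraph {g : H} {p : WithLp 2 (H × Lp ℂ 2 μ)} :
    p ∈ π.coeffGraph μ g ↔ p.snd =ᵐ[μ] π.coeff g p.fst := Iff.rfl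

/-- Convergence in `L²` gives a.e. convergence along a subsequence, while `V_g f_n → V_g f`
pointwise, so the limits agree. -/
lemma isClosed_coeffGraph (g : H) :
    IsClosed (π.coeffGraph μ g : Set (WithLp 2 (H × Lp ℂ 2 μ))) := by
  refine IsSeqClosed.isClosed fun p q hp hpq => ?_
  have h1 : Tendsto (fun n => (p n).fst) atTop (𝓝 q.fst) :=
    ((WithLp.fstL 2 ℂ H (Lp ℂ 2 μ)).continuous.tendsto q).comp hpq
  have h2 : Tendsto (fun n => (p n).snd) atTop (𝓝 q.snd) :=
    ((WithLp.sndL 2 ℂ H (Lp ℂ 2 μ)).continuous.tendsto q).comp hpq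
  obtain ⟨φ, hφ, hae⟩ := (tendstoInMeasure_of_tendsto_Lp h2).exists_seq_tendsto_ae
  have hall : ∀ᵐ x ∂μ, ∀ n, (p n).snd x = π.coeff g (p n).fst x :=
    ae_all_iff.2 fun n => mem_coeffGraph.1 (hp n)
  change q ∈ π.coeffGraph μ g
  rw [mem_coeffGraph]
  filter_upwards [hae, hall] with x hx hn
  refine tendsto_nhds_unique hx ?_
  simp_rw [hn]
  exact (tendsto_const_nhds.inner h1).comp hφ.tendsto_atTop

variable {π μ}

/-- The point of the graph over a vector `f` with `V_g f ∈ L²`. -/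
noncomputable def coeffGraphMk {g f : H} (hf : MemLp (π.coeff g f) 2 μ) : π.coeffGraph μ g :=
  ⟨WithLp.toLp 2 (f, hf.toLp _), hf.coeFn_toLp⟩

lemma coeffGraphMk_fst {g f : H} (hf : MemLp (π.coeff g f) 2 μ) :
    (coeffGraphMk hf).1.fst = f := rfl

lemma memLp_coeff_of_coeffGraph {g : H} (v : π.coeffGraph μ g) :
    MemLp (π.coeff g v.1.fst) 2 μ :=
  (memLp_congr_ae (mem_coeffGraph.1 v.2)).1 (Lp.memLp v.1.snd)

lemma coeffGraph_ext {g : H} {v w : π.coeffGraph μ g} (h : v.1.fst = w.1.fst) : v = w := by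
  apply Subtype.ext
  refine WithLp.ofLp_injective 2 (Prod.ext h (Lp.ext ?_))
  filter_upwards [mem_coeffGraph.1 v.2, mem_coeffGraph.1 w.2] with x hv hw
  exact hv.trans ((by rw [h] : π.coeff g v.1.fst x = π.coeff g w.1.fst x).trans hw.symm)

lemma inner_coeffGraph {g : H} (v w : π.coeffGraph μ g) :
    inner ℂ v w = inner ℂ v.1.fst w.1.fst +
      ∫ x, π.coeff g w.1.fst x * starRingEnd ℂ (π.coeff g v.1.fst x) ∂μ := by
  rw [Submodule.coe_inner, WithLp.prod_inner_apply, L2.inner_def]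
  congr 1
  refine integral_congr_ae ?_
  filter_upwards [mem_coeffGraph.1 v.2, mem_coeffGraph.1 w.2] with x hv hw
  rw [WithLp.snd] at hv hw
  rw [RCLike.inner_apply, hv, hw]

end Graph

/-! ### Orthogonality relations for a fixed window -/

section Orthogonality

variable {G H : Type*} [Group G] [TopologicalSpace G] [IsTopologicalGroup G]
  [MeasurableSpace G] [BorelSpace G] [NormedAddCommGroup H] [InnerProductSpace ℂ H]
  {π : ProjectiveRep G H} {μ : Measure G}

lemma memLp_coeff_op [μ.IsMulLeftInvariant] {g f : H} (hf : MemLp (π.coeff g f) 2 μ) (y : G) :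
    MemLp (π.coeff g (π.op y f)) 2 μ :=
  (hf.comp_measurePreserving (measurePreserving_mul_left μ y⁻¹)).congr_norm
    (π.stronglyMeasurable_coeff _ _).aestronglyMeasurable
    (Eventually.of_forall fun x => (π.norm_coeff_op_left g f y x).symm)

lemma memLp_coeff_symm_op [μ.IsMulLeftInvariant] {g f : H} (hf : MemLp (π.coeff g f) 2 μ)
    (y : G) : MemLp (π.coeff g ((π.op y).symm f)) 2 μ :=
  (hf.comp_measurePreserving (measurePreserving_mul_left μ y)).congr_norm
    (π.stronglyMeasurable_coeff _ _).aestronglyMeasurable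
    (Eventually.of_forall fun x => π.norm_coeff_mul_left g f y x)

lemma integral_coeff_op_mul [μ.IsMulLeftInvariant] (g f f' : H) (y : G) :
    ∫ x, π.coeff g (π.op y f) x * starRingEnd ℂ (π.coeff g f' x) ∂μ =
      ∫ x, π.coeff g f x * starRingEnd ℂ (π.coeff g ((π.op y).symm f') x) ∂μ := by
  rw [← integral_mul_left_eq_self _ y]
  congr 1
  funext x
  obtain ⟨c, hc, h⟩ := π.exists_coeff_mul_left y x
  rw [h, h, LinearIsometryEquiv.symm_apply_apply, map_mul, mul_mul_mul_comm, RCLike.mul_conj, hc]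
  simp

set_option maxHeartbeats 1000000 in
/-- If one nonzero `V_g f` is square integrable, then all are, and `f ↦ V_g f` is a multiple of
an isometry. -/
theorem IsIrreducible.exists_integral_coeff_eq [CompleteSpace H] [μ.IsMulLeftInvariant]
    (hπ : π.IsIrreducible) {g f₀ : H} (hf₀ : f₀ ≠ 0) (hL : MemLp (π.coeff g f₀) 2 μ) :
    ∃ C : ℝ, ∀ f, MemLp (π.coeff g f) 2 μ ∧ ∀ f',
      ∫ x, π.coeff g f x * starRingEnd ℂ (π.coeff g f' x) ∂μ = C * inner ℂ f' f := by
  have : CompleteSpace (π.coeffGraph μ g) := (π.isClosed_coeffGraph μ g).completeSpace_coe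
  let J : π.coeffGraph μ g →L[ℂ] H :=
    (WithLp.fstL 2 ℂ H (Lp ℂ 2 μ)).comp (π.coeffGraph μ g).subtypeL
  have hJ : ∀ v, J v = v.1.fst := fun v => rfl
  -- `J` is bounded even if `V_g` is not known to be; `J J*` plays the role of `(1 + V_g* V_g)⁻¹`.
  let T : H →L[ℂ] H := J.comp J.adjoint
  have hTsa : IsSelfAdjoint T := by
    rw [ContinuousLinearMap.isSelfAdjoint_iff', ContinuousLinearMap.adjoint_comp,
      ContinuousLinearMap.adjoint_adjoint]
  have hadj : ∀ v h, inner ℂ v (J.adjoint h) = inner ℂ v.1.fst h := fun v h =>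
    ContinuousLinearMap.adjoint_inner_right J v h
  have hcomm : ∀ y h, T (π.op y h) = π.op y (T h) := by
    intro y h
    have hu := memLp_coeff_of_coeffGraph (J.adjoint h)
    suffices J.adjoint (π.op y h) = coeffGraphMk (memLp_coeff_op hu y) by
      change J (J.adjoint (π.op y h)) = _
      rw [this, hJ, coeffGraphMk_fst]
      rfl
    refine ext_inner_left ℂ fun v => ?_
    have hw := memLp_coeff_symm_op (memLp_coeff_of_coeffGraph v) y
    have h1 : inner ℂ (coeffGraphMk hw) (J.adjoint h) = inner ℂ ((π.op y).symm v.1.fst) h := by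
      rw [hadj, coeffGraphMk_fst]
    rw [hadj, inner_coeffGraph, coeffGraphMk_fst]
    rw [inner_coeffGraph, coeffGraphMk_fst] at h1
    rw [LinearIsometryEquiv.inner_map_eq_flip, LinearIsometryEquiv.inner_map_eq_flip,
      LinearIsometryEquiv.symm_symm] at h1
    rw [integral_coeff_op_mul]
    exact h1.symm
  obtain ⟨r, hr⟩ := hπ.exists_eq_smul_of_commute hTsa hcomm
  have hTJ : ∀ h, J (J.adjoint h) = r • h := hr
  have hr0 : r ≠ 0 := by
    rintro rfl
    have h1 : J.adjoint f₀ = 0 := by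
      apply coeffGraph_ext
      rw [← hJ, hTJ]
      simp
    have h2 : inner ℂ (coeffGraphMk hL) (J.adjoint f₀) = inner ℂ f₀ f₀ := by
      rw [hadj, coeffGraphMk_fst]
    rw [h1, inner_zero_right] at h2
    exact hf₀ (inner_self_eq_zero.1 h2.symm)
  have hmem : ∀ f, MemLp (π.coeff g f) 2 μ := by
    intro f
    have h := memLp_coeff_of_coeffGraph (J.adjoint (r⁻¹ • f))
    rwa [← hJ, hTJ, smul_inv_smul₀ hr0] at h
  -- `J*(r⁻¹ f)` is the graph point over `f`, so the graph inner product is `r⁻¹ ⟨f', f⟩`; removing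
  -- its `H` component leaves `r⁻¹ - 1`.
  refine ⟨r⁻¹ - 1, fun f => ⟨hmem f, fun f' => ?_⟩⟩
  have h1 := inner_coeffGraph (coeffGraphMk (hmem f')) (coeffGraphMk (hmem f))
  have h2 : J.adjoint (r⁻¹ • f) = coeffGraphMk (hmem f) := by
    apply coeffGraph_ext
    rw [← hJ, hTJ, smul_inv_smul₀ hr0, coeffGraphMk_fst]
  rw [← h2, hadj, h2] at h1
  simp only [coeffGraphMk_fst] at h1
  rw [← Complex.coe_smul, inner_smul_right] at h1
  push_cast at h1 ⊢
  linear_combination -h1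

end Orthogonality

end ProjectiveRep

/-- Polarization: a sesquilinear form is determined by its diagonal. -/
lemma sesqForm_eq_of_diag_eq {E : Type*} [NormedAddCommGroup E] [InnerProductSpace ℂ E]
    (B : E → E → ℂ) (hadd_left : ∀ x y z, B (x + y) z = B x z + B y z)
    (hadd_right : ∀ x y z, B x (y + z) = B x y + B x z)
    (hsmul_left : ∀ (c : ℂ) x y, B (c • x) y = starRingEnd ℂ c * B x y)
    (hsmul_right : ∀ (c : ℂ) x y, B x (c • y) = c * B x y) (k : ℂ)
    (hdiag : ∀ x, B x x = k * inner ℂ x x) (x y : E) : B x y = k * inner ℂ x y := by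
  have h1 := hdiag (x + y)
  have h2 := hdiag (x + Complex.I • y)
  simp only [hadd_left, hadd_right, hsmul_left, hsmul_right, hdiag, inner_add_left,
    inner_add_right, inner_smul_left, inner_smul_right, Complex.conj_I] at h1 h2
  linear_combination (1 / 2 : ℂ) * h1 - (Complex.I / 2) * h2 +
    (1 / 2) * (B x y - B y x - k * inner ℂ x y + k * inner ℂ y x) * Complex.I_mul_I

/-! ### Existence and uniqueness of the formal degree -/

namespace ProjectiveRep

variable {G H : Type*} [Group G] [TopologicalSpace G] [MeasurableSpace G]
  [NormedAddCommGroup H] [InnerProductSpace ℂ H] {π : ProjectiveRep G H} {μ : Measure G}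

lemma memLp_coeff_iff (g f : H) :
    MemLp (π.coeff g f) 2 μ ↔ ∫⁻ x, ‖π.coeff g f x‖ₑ ^ 2 ∂μ < ∞ := by
  have hm := (π.stronglyMeasurable_coeff g f).aestronglyMeasurable (μ := μ)
  rw [MemLp, and_iff_right hm, eLpNorm_lt_top_iff_lintegral_rpow_enorm_lt_top (by simp) (by simp)]
  simp

lemma integrable_coeff_mul_conj {g₁ g₂ f₁ f₂ : H} (h₁ : MemLp (π.coeff g₁ f₁) 2 μ)
    (h₂ : MemLp (π.coeff g₂ f₂) 2 μ) :
    Integrable (fun x => π.coeff g₁ f₁ x * starRingEnd ℂ (π.coeff g₂ f₂ x)) μ :=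
  h₁.integrable_mul h₂.star

lemma coeff_mul_conj_self (g f : H) (x : G) :
    π.coeff g f x * starRingEnd ℂ (π.coeff g f x) = ((‖π.coeff g f x‖ ^ 2 : ℝ) : ℂ) := by
  rw [RCLike.mul_conj]
  push_cast
  rfl

lemma IsFormalDegree.lintegral_enorm_coeff_sq {d : ℝ} (hd : π.IsFormalDegree μ d) (g f : H) :
    ∫⁻ x, ‖π.coeff g f x‖ₑ ^ 2 ∂μ = ENNReal.ofReal (d⁻¹ * ‖f‖ ^ 2 * ‖g‖ ^ 2) := by
  obtain ⟨hi, he⟩ := hd.2 f f g g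
  simp_rw [coeff_mul_conj_self] at hi he
  have hi' : Integrable (fun x => ‖π.coeff g f x‖ ^ 2) μ := by
    have := hi.re
    simpa only [RCLike.re_to_complex, Complex.ofReal_re] using this
  rw [integral_complex_ofReal, inner_self_eq_norm_sq_to_K, inner_self_eq_norm_sq_to_K] at he
  have he' : ∫ x, ‖π.coeff g f x‖ ^ 2 ∂μ = d⁻¹ * ‖f‖ ^ 2 * ‖g‖ ^ 2 := by
    simp only [Complex.coe_algebraMap, map_pow, Complex.conj_ofReal] at he
    exact_mod_cast he
  rw [← he', ofReal_integral_eq_lintegral_ofReal hi' (Eventually.of_forall fun x => by positivity)]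
  congr 1
  funext x
  rw [ENNReal.ofReal_pow (norm_nonneg _), ofReal_norm]

lemma IsFormalDegree.unique [Nontrivial H] {d d' : ℝ} (hd : π.IsFormalDegree μ d)
    (hd' : π.IsFormalDegree μ d') : d = d' := by
  obtain ⟨h, hh⟩ := exists_ne (0 : H)
  have h1 := hd.lintegral_enorm_coeff_sq h h
  have hpos := hd.1
  have hpos' := hd'.1
  rw [hd'.lintegral_enorm_coeff_sq h h, ENNReal.ofReal_eq_ofReal_iff (by positivity)
    (by positivity)] at h1
  have hn : ‖h‖ ≠ 0 := norm_ne_zero_iff.2 hh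
  field_simp at h1
  exact h1

section Existence

variable [IsTopologicalGroup G] [BorelSpace G]

/-- Inversion exchanges window and vector; this is where unimodularity enters the orthogonality
relations. -/
lemma memLp_coeff_swap [μ.IsInvInvariant] {g f : H} (h : MemLp (π.coeff g f) 2 μ) :
    MemLp (π.coeff f g) 2 μ :=
  (h.comp_measurePreserving (Measure.measurePreserving_inv μ)).congr_norm
    (π.stronglyMeasurable_coeff _ _).aestronglyMeasurable
    (Eventually.of_forall fun x => π.norm_coeff_inv g f x)

lemma integral_coeff_mul_conj_swap [μ.IsInvInvariant] (g f : H) :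
    ∫ x, π.coeff g f x * starRingEnd ℂ (π.coeff g f x) ∂μ =
      ∫ x, π.coeff f g x * starRingEnd ℂ (π.coeff f g x) ∂μ := by
  rw [← integral_inv_eq_self]
  simp_rw [coeff_mul_conj_self, norm_coeff_inv]

variable [LocallyCompactSpace G] [T2Space G] [SecondCountableTopology G]
  [TopologicalSpace.SeparableSpace H]

lemma integral_norm_coeff_self_sq_pos [μ.IsOpenPosMeasure] {g : H} (hg : g ≠ 0)
    (h : MemLp (π.coeff g g) 2 μ) : 0 < ∫ x, ‖π.coeff g g x‖ ^ 2 ∂μ := by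
  rw [integral_pos_iff_support_of_nonneg (fun x => by positivity)
    ((memLp_two_iff_integrable_sq_norm h.1).1 h)]
  have ho : IsOpen (Function.support fun x => ‖π.coeff g g x‖ ^ 2) :=
    ((π.continuous_norm_coeff g g).pow 2).isOpen_support
  refine ho.measure_pos μ ⟨1, ?_⟩
  rw [Function.mem_support, norm_coeff_self_one]
  positivity

/-- The **orthogonality relations** for discrete series representations of unimodular groups. -/
theorem IsDiscreteSeries.exists_isFormalDegree [CompleteSpace H] [μ.IsHaarMeasure]
    [μ.IsInvInvariant] (hπ : π.IsDiscreteSeries μ) : ∃ d : ℝ, π.IsFormalDegree μ d := by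
  obtain ⟨hirr, g₀, hg₀, hfin⟩ := hπ
  obtain ⟨C₀, hC₀⟩ := hirr.exists_integral_coeff_eq hg₀ ((memLp_coeff_iff g₀ g₀).2 hfin)
  have hall : ∀ g, ∃ C : ℝ, ∀ f, MemLp (π.coeff g f) 2 μ ∧ ∀ f',
      ∫ x, π.coeff g f x * starRingEnd ℂ (π.coeff g f' x) ∂μ = C * inner ℂ f' f := fun g =>
    hirr.exists_integral_coeff_eq hg₀ (memLp_coeff_swap (hC₀ g).1)
  choose C hC using hall
  -- Exchanging `g` and `g₀` gives `C g * ‖g₀‖² = C g₀ * ‖g‖²`, so `C g = k ‖g‖²` and the formal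
  -- degree is `k⁻¹`.
  set k : ℝ := C g₀ / ‖g₀‖ ^ 2 with hk
  have hCk : ∀ g, (C g : ℂ) = k * inner ℂ g g := by
    intro g
    have h1 := (hC g g₀).2 g₀
    rw [integral_coeff_mul_conj_swap, (hC g₀ g).2 g] at h1
    have hg₀' : (‖g₀‖ : ℂ) ≠ 0 := by exact_mod_cast (norm_ne_zero_iff.2 hg₀)
    rw [inner_self_eq_norm_sq_to_K, inner_self_eq_norm_sq_to_K] at h1
    rw [inner_self_eq_norm_sq_to_K, hk]
    push_cast
    field_simp
    exact h1.symm
  have hkpos : 0 < k := by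
    have h1 := integral_norm_coeff_self_sq_pos hg₀ (hC g₀ g₀).1
    have h2 := (hC g₀ g₀).2 g₀
    simp_rw [coeff_mul_conj_self] at h2
    rw [integral_complex_ofReal, inner_self_eq_norm_sq_to_K] at h2
    simp only [Complex.coe_algebraMap] at h2
    have h3 : ∫ x, ‖π.coeff g₀ g₀ x‖ ^ 2 ∂μ = C g₀ * ‖g₀‖ ^ 2 := by exact_mod_cast h2
    have hg₀' : 0 < ‖g₀‖ := norm_pos_iff.2 hg₀
    rw [h3] at h1
    have : 0 < C g₀ := pos_of_mul_pos_left h1 (by positivity)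
    positivity
  refine ⟨k⁻¹, inv_pos.2 hkpos, fun f₁ f₂ g₁ g₂ =>
    ⟨integrable_coeff_mul_conj (hC g₁ f₁).1 (hC g₂ f₂).1, ?_⟩⟩
  have hi : ∀ g g', Integrable (fun x => π.coeff g f₁ x * starRingEnd ℂ (π.coeff g' f₂ x)) μ :=
    fun g g' => integrable_coeff_mul_conj (hC g f₁).1 (hC g' f₂).1
  -- Polarization in the windows, with `f₁` and `f₂` fixed.
  have := sesqForm_eq_of_diag_eq
    (fun g g' => ∫ x, π.coeff g f₁ x * starRingEnd ℂ (π.coeff g' f₂ x) ∂μ)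
    (fun x y z => by
      rw [← integral_add (hi _ _) (hi _ _)]
      simp_rw [coeff_add_left, add_mul])
    (fun x y z => by
      rw [← integral_add (hi _ _) (hi _ _)]
      simp_rw [coeff_add_left, map_add, mul_add])
    (fun c x y => by
      rw [← integral_const_mul]
      simp_rw [coeff_smul_left, mul_assoc])
    (fun c x y => by
      rw [← integral_const_mul]
      simp_rw [coeff_smul_left, map_mul, RCLike.conj_conj, mul_left_comm])
    (k * inner ℂ f₂ f₁)
    (fun g => by
      rw [(hC g f₁).2 f₂, hCk]
      ring) g₁ g₂
  rw [inner_conj_symm, Complex.ofReal_inv, inv_inv]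
  exact this

end Existence

end ProjectiveRep

/-! ### Approximation by finitely many dual frame vectors -/

section Frames

lemma memℓp_two_of_tsum_enorm_sq_ne_top {ι : Type*} {x : ι → ℂ}
    (h : ∑' i, ‖x i‖ₑ ^ 2 ≠ ∞) : Memℓp x 2 := by
  refine memℓp_gen ?_
  have := ENNReal.summable_toReal h
  simpa using this

lemma lp_two_ofReal_norm_sq {ι : Type*} (x : lp (fun _ : ι => ℂ) 2) :
    ENNReal.ofReal (‖x‖ ^ 2) = ∑' i, ‖x i‖ₑ ^ 2 := by
  have hs := lp.hasSum_norm (p := 2) (by simp) x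
  simp only [ENNReal.toReal_ofNat, Real.rpow_ofNat] at hs
  rw [← hs.tsum_eq, ENNReal.ofReal_tsum_of_nonneg (fun i => by positivity) hs.summable]
  congr 1
  funext i
  rw [ENNReal.ofReal_pow (norm_nonneg _), ofReal_norm]

variable {H ι : Type*} [NormedAddCommGroup H] [InnerProductSpace ℂ H]

/-- The analysis operator of a Bessel family. -/
lemma exists_analysis {e : ι → H} {B : ℝ} (hB : 0 ≤ B)
    (h : ∀ f, ∑' i, ‖(inner ℂ (e i) f : ℂ)‖ₑ ^ 2 ≤ ENNReal.ofReal (B * ‖f‖ ^ 2)) :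
    ∃ L : H →L[ℂ] lp (fun _ : ι => ℂ) 2, ∀ f i, L f i = inner ℂ (e i) f := by
  have hmem : ∀ f, Memℓp (fun i => (inner ℂ (e i) f : ℂ)) 2 := fun f =>
    memℓp_two_of_tsum_enorm_sq_ne_top ((h f).trans_lt ENNReal.ofReal_lt_top).ne
  let L : H →ₗ[ℂ] lp (fun _ : ι => ℂ) 2 :=
    { toFun := fun f => ⟨fun i => inner ℂ (e i) f, hmem f⟩
      map_add' := fun f f' => by
        ext i
        exact inner_add_right _ _ _
      map_smul' := fun c f => by
        ext i
        exact inner_smul_right _ _ _ }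
  refine ⟨L.mkContinuous (√B) fun f => ?_, fun f i => rfl⟩
  have h1 : ENNReal.ofReal (‖L f‖ ^ 2) ≤ ENNReal.ofReal (B * ‖f‖ ^ 2) :=
    (lp_two_ofReal_norm_sq _).trans_le (h f)
  rw [ENNReal.ofReal_le_ofReal_iff (by positivity)] at h1
  refine abs_le_of_sq_le_sq' ?_ (by positivity) |>.2
  rw [mul_pow, Real.sq_sqrt hB]
  exact h1

variable [CompleteSpace H]

open Classical in
/-- Up to an error controlled by the frame coefficients outside a finite set `s`, every vector is
approximated from a fixed subspace of dimension at most `s.card`. -/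
theorem exists_submodule_finrank_le_of_frame {e : ι → H} {A B : ℝ} (hA : 0 < A) (hB : 0 ≤ B)
    (h : ∀ f, ENNReal.ofReal (A * ‖f‖ ^ 2) ≤ ∑' i, ‖(inner ℂ (e i) f : ℂ)‖ₑ ^ 2 ∧
      ∑' i, ‖(inner ℂ (e i) f : ℂ)‖ₑ ^ 2 ≤ ENNReal.ofReal (B * ‖f‖ ^ 2)) (s : Finset ι) :
    ∃ V : Submodule ℂ H, FiniteDimensional ℂ V ∧ Module.finrank ℂ V ≤ s.card ∧
      ∀ f, ∃ v ∈ V, ENNReal.ofReal (A * ‖f - v‖ ^ 2) ≤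
        ∑' i, if i ∈ s then 0 else ‖(inner ℂ (e i) f : ℂ)‖ₑ ^ 2 := by
  obtain ⟨L, hL⟩ := exists_analysis hB fun f => (h f).2
  have hlow : ∀ f, A * ‖f‖ ^ 2 ≤ ‖L f‖ ^ 2 := by
    intro f
    rw [← ENNReal.ofReal_le_ofReal_iff (by positivity), lp_two_ofReal_norm_sq]
    simp_rw [hL]
    exact (h f).1
  have hanti : AntilipschitzWith (Real.toNNReal (√A)⁻¹) L := by
    refine ContinuousLinearMap.antilipschitz_of_bound L fun f => ?_
    rw [Real.coe_toNNReal _ (by positivity), inv_mul_eq_div, le_div_iff₀ (by positivity)]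
    refine abs_le_of_sq_le_sq' ?_ (by positivity) |>.2
    rw [mul_pow, Real.sq_sqrt hA.le, mul_comm]
    exact hlow f
  have hinj : Function.Injective L.toLinearMap := hanti.injective
  have hcl : IsClosed (LinearMap.range L.toLinearMap : Set (lp (fun _ : ι => ℂ) 2)) :=
    hanti.isClosed_range L.uniformContinuous
  have : CompleteSpace (LinearMap.range L.toLinearMap) := hcl.completeSpace_coe
  let R := LinearMap.range L.toLinearMap
  -- `D` is the pseudo-inverse of `L`, the synthesis operator of the canonical dual frame; the lower
  -- bound gives `‖D‖² ≤ A⁻¹`.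
  let D : lp (fun _ : ι => ℂ) 2 →ₗ[ℂ] H :=
    (LinearEquiv.ofInjective L.toLinearMap hinj).symm.toLinearMap ∘ₗ
      R.orthogonalProjectionOnto.toLinearMap
  have hLD : ∀ x, L (D x) = R.orthogonalProjectionOnto x := fun x =>
    congrArg Subtype.val ((LinearEquiv.ofInjective L.toLinearMap hinj).apply_symm_apply
      (R.orthogonalProjectionOnto x))
  have hDL : ∀ f, D (L f) = f := by
    intro f
    apply hinj
    change L (D (L f)) = L f
    rw [hLD]
    exact R.orthogonalProjectionOnto_mem_subspace_eq_self ⟨L f, LinearMap.mem_range_self _ f⟩ ▸ rfl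
  have hD : ∀ x, A * ‖D x‖ ^ 2 ≤ ‖x‖ ^ 2 := by
    intro x
    refine (hlow _).trans ?_
    rw [hLD]
    gcongr
    exact R.norm_orthogonalProjectionOnto_apply_le x
  let w : ι → H := fun i => D (lp.single (E := fun _ : ι => ℂ) 2 i 1)
  refine ⟨Submodule.span ℂ (s.image w : Set H), FiniteDimensional.span_finset ℂ _,
    (finrank_span_finset_le_card _).trans Finset.card_image_le, fun f => ?_⟩
  -- Synthesis from the coefficients in `s` only; the error is `D` applied to the remaining ones.
  refine ⟨D (∑ i ∈ s, lp.single 2 i (L f i)), ?_, ?_⟩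
  · rw [map_sum]
    refine Submodule.sum_mem _ fun i hi => ?_
    have : lp.single 2 i (L f i) = L f i • lp.single (E := fun _ : ι => ℂ) 2 i 1 := by
      rw [← lp.single_smul, smul_eq_mul, mul_one]
    rw [this, map_smul]
    exact Submodule.smul_mem _ _ (Submodule.subset_span (Finset.mem_coe.2
      (Finset.mem_image_of_mem w hi)))
  · set x := ∑ i ∈ s, lp.single 2 i (L f i) with hx
    have h1 : f - D x = D (L f - x) := by rw [map_sub, hDL]
    have hcoord : ∀ j, (L f - x) j = if j ∈ s then 0 else inner ℂ (e j) f := by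
      intro j
      rw [lp.coeFn_sub, Pi.sub_apply, hx, lp.coeFn_sum, Finset.sum_apply]
      simp_rw [lp.single_apply, Pi.single_apply]
      rw [Finset.sum_ite_eq]
      split_ifs <;> simp [hL]
    rw [h1]
    refine (ENNReal.ofReal_le_ofReal (hD _)).trans_eq ?_
    rw [lp_two_ofReal_norm_sq]
    congr 1
    funext j
    rw [hcoord]
    split_ifs <;> simp

end Frames

/-! ### The dimension count -/

namespace ProjectiveRep

variable {G H : Type*} [Group G] [TopologicalSpace G] [MeasurableSpace G]
  [NormedAddCommGroup H] [InnerProductSpace ℂ H] [CompleteSpace H]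
  {π : ProjectiveRep G H} {μ : Measure G}

open Classical in
theorem IsFrameWithBounds.measure_mul_norm_sq_le {d : ℝ} (hd : π.IsFormalDegree μ d)
    {Λ : Set G} {g : H} {A B : ℝ} (hΛ : π.IsFrameWithBounds Λ g A B) {K : Set G}
    (hfin : (Λ ∩ K).Finite) :
    μ K * ENNReal.ofReal (‖g‖ ^ 2) ≤
      (Λ ∩ K).ncard * ENNReal.ofReal (d⁻¹ * ‖g‖ ^ 2) +
        ENNReal.ofReal A⁻¹ * ∫⁻ y in K, ∑' l : Λ,
          if (l : G) ∈ K then 0 else ‖π.coeff g g (y⁻¹ * l)‖ₑ ^ 2 ∂μ := by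
  obtain ⟨hA, hB, hfr⟩ := hΛ
  have hfin' : {l : Λ | (l : G) ∈ K}.Finite := by
    refine Set.Finite.of_finite_image (f := Subtype.val) ?_ Subtype.val_injective.injOn
    refine hfin.subset ?_
    rintro _ ⟨l, hl, rfl⟩
    exact ⟨l.2, hl⟩
  let s : Finset Λ := hfin'.toFinset
  have hs : ∀ l : Λ, l ∈ s ↔ (l : G) ∈ K := fun l => hfin'.mem_toFinset
  have hcard : s.card ≤ (Λ ∩ K).ncard := by
    rw [← Set.ncard_eq_toFinset_card _ hfin', ← Set.ncard_image_of_injective _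
      Subtype.val_injective]
    refine Set.ncard_le_ncard ?_ hfin
    rintro _ ⟨l, hl, rfl⟩
    exact ⟨l.2, hl⟩
  obtain ⟨V, hV, hdim, happ⟩ := exists_submodule_finrank_le_of_frame hA hB.le
    (e := fun l : Λ => π.op l g) hfr s
  let b := stdOrthonormalBasis ℂ V
  have hpt : ∀ y, ENNReal.ofReal (‖g‖ ^ 2) ≤ ∑ i, ‖π.coeff g (b i) y‖ₑ ^ 2 +
      ENNReal.ofReal A⁻¹ * ∑' l : Λ,
        if (l : G) ∈ K then 0 else ‖π.coeff g g (y⁻¹ * l)‖ₑ ^ 2 := by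
    intro y
    obtain ⟨v, hv, hle⟩ := happ (π.op y g)
    have hsq : ‖g‖ ^ 2 ≤ ∑ i, ‖π.coeff g (b i) y‖ ^ 2 + ‖π.op y g - v‖ ^ 2 := by
      have h1 := V.norm_sq_eq_add_norm_sq_projection (π.op y g)
      have h2 := b.sum_sq_norm_inner_left (V.orthogonalProjectionOnto (π.op y g))
      have h3 : ∀ i, ‖(inner ℂ (V.orthogonalProjectionOnto (π.op y g)) (b i) : ℂ)‖ =
          ‖π.coeff g (b i) y‖ := by
        intro i
        rw [coeff, ← V.inner_orthogonalProjectionOnto_eq_of_mem_right]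
      have h4 : ‖Vᗮ.orthogonalProjectionOnto (π.op y g)‖ ≤ ‖π.op y g - v‖ := by
        have h5 : Vᗮ.orthogonalProjectionOnto (π.op y g) =
            Vᗮ.orthogonalProjectionOnto (π.op y g - v) := by
          rw [map_sub, V.orthogonalProjectionOnto_orthogonal_apply_eq_zero hv, sub_zero]
        rw [h5]
        exact Vᗮ.norm_orthogonalProjectionOnto_apply_le _
      simp_rw [h3] at h2
      rw [LinearIsometryEquiv.norm_map] at h1
      rw [h1, h2]
      gcongr
    have hsum : ENNReal.ofReal (∑ i, ‖π.coeff g (b i) y‖ ^ 2) =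
        ∑ i, ‖π.coeff g (b i) y‖ₑ ^ 2 := by
      rw [ENNReal.ofReal_sum_of_nonneg fun i _ => by positivity]
      refine Finset.sum_congr rfl fun i _ => ?_
      rw [ENNReal.ofReal_pow (norm_nonneg _), ofReal_norm]
    refine (ENNReal.ofReal_le_ofReal hsq).trans ?_
    rw [ENNReal.ofReal_add (Finset.sum_nonneg fun i _ => by positivity) (by positivity), hsum]
    gcongr
    have h6 : ‖π.op y g - v‖ ^ 2 = A⁻¹ * (A * ‖π.op y g - v‖ ^ 2) := by field_simp
    rw [h6, ENNReal.ofReal_mul (by positivity)]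
    gcongr
    refine hle.trans_eq ?_
    congr 1
    funext l
    simp only [hs]
    split_ifs
    · rfl
    · have := π.norm_coeff_op_left g g y l
      change ‖π.coeff g (π.op y g) l‖ₑ ^ 2 = _
      rw [← ofReal_norm, this, ofReal_norm]
  have hmeas : ∀ i, Measurable fun y => ‖π.coeff g (b i) y‖ₑ ^ 2 := fun i =>
    (π.stronglyMeasurable_coeff g (b i)).measurable.enorm.pow_const 2
  calc μ K * ENNReal.ofReal (‖g‖ ^ 2)
      = ∫⁻ y in K, ENNReal.ofReal (‖g‖ ^ 2) ∂μ := by rw [setLIntegral_const, mul_comm]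
    _ ≤ ∫⁻ y in K, (∑ i, ‖π.coeff g (b i) y‖ₑ ^ 2 + ENNReal.ofReal A⁻¹ * ∑' l : Λ,
        if (l : G) ∈ K then 0 else ‖π.coeff g g (y⁻¹ * l)‖ₑ ^ 2) ∂μ :=
        lintegral_mono fun y => hpt y
    _ = ∑ i, ∫⁻ y in K, ‖π.coeff g (b i) y‖ₑ ^ 2 ∂μ + ENNReal.ofReal A⁻¹ *
        ∫⁻ y in K, ∑' l : Λ, if (l : G) ∈ K then 0 else ‖π.coeff g g (y⁻¹ * l)‖ₑ ^ 2 ∂μ := by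
        -- Only the first summand has to be measurable, so nothing is needed about the sum over `Λ`.
        rw [lintegral_add_left (Finset.measurable_sum _ fun i _ => hmeas i),
          lintegral_finsetSum _ fun i _ => hmeas i,
          lintegral_const_mul' _ _ ENNReal.ofReal_ne_top]
    _ ≤ _ := by
        gcongr
        calc ∑ i, ∫⁻ y in K, ‖π.coeff g (b i) y‖ₑ ^ 2 ∂μ
            ≤ ∑ i, ENNReal.ofReal (d⁻¹ * ‖g‖ ^ 2) := by
              refine Finset.sum_le_sum fun i _ => (setLIntegral_le_lintegral _ _).trans_eq ?_
              have hb : ‖(b i : H)‖ = 1 := b.orthonormal.1 i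
              rw [hd.lintegral_enorm_coeff_sq, hb, one_pow, mul_one]
          _ = (Module.finrank ℂ V : ℝ≥0∞) * ENNReal.ofReal (d⁻¹ * ‖g‖ ^ 2) := by
              rw [Finset.sum_const, Finset.card_univ, Fintype.card_fin, nsmul_eq_mul]
          _ ≤ _ := by
              gcongr
              exact hdim.trans hcard

end ProjectiveRep

/-! ### The local maximal function -/

section LocalMax

lemma enorm_le_localMax {G : Type*} [Group G] {F : G → ℂ} {Q : Set G} (x : G)
    {q : G} (hq : q ∈ Q) : ‖F (x * q)‖ₑ ≤ localMax Q F x :=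
  le_iSup₂_of_le q hq le_rfl

variable {G : Type*} [Group G] [TopologicalSpace G] [IsTopologicalGroup G]

/-- A compact set is covered by finitely many translates of a neighbourhood of the unit. -/
lemma IsCompact.exists_finset_subset_biUnion_smul {S U : Set G} (hS : IsCompact S)
    (hU : U ∈ 𝓝 (1 : G)) : ∃ t : Finset G, S ⊆ ⋃ x ∈ t, x • U := by
  obtain ⟨t, -, ht⟩ := hS.elim_nhds_subcover (fun x => x • U) fun x _ => by
    simpa using smul_mem_nhds_smul x hU
  exact ⟨t, ht⟩

variable [MeasurableSpace G] [BorelSpace G]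

lemma measurable_localMax {F : G → ℂ} (hF : Continuous fun x => ‖F x‖ₑ) (Q : Set G) :
    Measurable (localMax Q F) := by
  refine LowerSemicontinuous.measurable ?_
  refine lowerSemicontinuous_biSup fun z _ => ?_
  exact (hF.comp (continuous_mul_const z)).lowerSemicontinuous

/-- Square integrability of the local maximal function does not depend on the neighbourhood. -/
lemma lintegral_localMax_sq_lt_top {μ : Measure G} [μ.IsMulRightInvariant] {F : G → ℂ}
    (hF : Continuous fun x => ‖F x‖ₑ) {Q Q' : Set G} (hQ : Q ∈ 𝓝 (1 : G))
    (hQ' : IsCompact (closure Q')) (h : ∫⁻ x, localMax Q F x ^ 2 ∂μ < ∞) :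
    ∫⁻ x, localMax Q' F x ^ 2 ∂μ < ∞ := by
  obtain ⟨t, ht⟩ := hQ'.exists_finset_subset_biUnion_smul hQ
  -- Finitely many translates `a • Q` cover `Q'`; right invariance then makes all summands equally
  -- integrable.
  have hpt : ∀ x, localMax Q' F x ^ 2 ≤ ∑ a ∈ t, localMax Q F (x * a) ^ 2 := by
    intro x
    have h1 : localMax Q' F x ≤ t.sup fun a => localMax Q F (x * a) := by
      refine iSup₂_le fun z hz => ?_
      obtain ⟨a, ha, hz'⟩ := Set.mem_iUnion₂.1 (ht (subset_closure hz))
      obtain ⟨q, hq, rfl⟩ := hz'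
      refine le_trans ?_ (Finset.le_sup (f := fun a => localMax Q F (x * a)) ha)
      change ‖F (x * (a * q))‖ₑ ≤ _
      rw [← mul_assoc]
      exact enorm_le_localMax _ hq
    rcases t.eq_empty_or_nonempty with rfl | hne
    · simp only [Finset.sup_empty, bot_eq_zero, nonpos_iff_eq_zero] at h1
      simp [h1]
    · obtain ⟨a, ha, hsup⟩ := t.exists_mem_eq_sup hne fun a => localMax Q F (x * a)
      rw [hsup] at h1
      exact (pow_le_pow_left₀ (zero_le) h1 2).trans
        (Finset.single_le_sum (f := fun a => localMax Q F (x * a) ^ 2) (fun _ _ => zero_le) ha)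
  refine (lintegral_mono hpt).trans_lt ?_
  have hm : ∀ a : G, Measurable fun x => localMax Q F (x * a) ^ 2 := fun a =>
    ((measurable_localMax hF Q).comp (measurable_mul_const a)).pow_const 2
  rw [lintegral_finsetSum _ fun a _ => hm a]
  refine ENNReal.sum_lt_top.2 fun a _ => ?_
  rwa [lintegral_mul_right_eq_self (fun x => localMax Q F x ^ 2) a]

end LocalMax

/-! ### Size of the error integral -/

section ErrorTerm

variable {G : Type*} [Group G] [TopologicalSpace G] [IsTopologicalGroup G]
  [MeasurableSpace G] [BorelSpace G] {μ : Measure G}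

lemma lintegral_lintegral_inv_mul_le [μ.IsMulLeftInvariant] {φ : G → ℝ≥0∞} (K : Set G)
    (E : Set G) :
    ∫⁻ y in K, ∫⁻ z in E, φ (y⁻¹ * z) ∂μ ∂μ ≤ μ K * ∫⁻ x, φ x ∂μ := by
  calc _ ≤ ∫⁻ y in K, ∫⁻ x, φ x ∂μ ∂μ := by
        refine lintegral_mono fun y => (setLIntegral_le_lintegral _ _).trans_eq ?_
        exact lintegral_mul_left_eq_self φ y⁻¹
    _ = _ := by rw [setLIntegral_const, mul_comm]

variable [SecondCountableTopology G]

/-- Integrating over `y` before `z` puts the measure of `E` in the bound; this pays off when `E` is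
a thin boundary region of `K`. -/
lemma lintegral_lintegral_inv_mul_le' [SFinite μ] [μ.IsMulRightInvariant] [μ.IsInvInvariant]
    {φ : G → ℝ≥0∞} (hφ : Measurable φ) (K : Set G) (E : Set G) :
    ∫⁻ y in K, ∫⁻ z in E, φ (y⁻¹ * z) ∂μ ∂μ ≤ μ E * ∫⁻ x, φ x ∂μ := by
  calc _ ≤ ∫⁻ y, ∫⁻ z in E, φ (y⁻¹ * z) ∂μ ∂μ := setLIntegral_le_lintegral _ _
    _ = ∫⁻ z in E, ∫⁻ y, φ (y⁻¹ * z) ∂μ ∂μ := by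
        refine lintegral_lintegral_swap (Measurable.aemeasurable ?_)
        exact hφ.comp (measurable_fst.inv.mul measurable_snd)
    _ = ∫⁻ z in E, ∫⁻ x, φ x ∂μ ∂μ := by
        congr 1
        funext z
        rw [lintegral_inv_eq_self fun y => φ (y * z), lintegral_mul_right_eq_self φ z]
    _ = _ := by rw [setLIntegral_const, mul_comm]

/-- Splitting the error integral into a part near the boundary of `K` and a tail. -/
lemma lintegral_lintegral_inv_mul_le_add [T2Space G] [SFinite μ] [μ.IsMulLeftInvariant]
    [μ.IsMulRightInvariant] [μ.IsInvInvariant] {φ : G → ℝ≥0∞} (hφ : Measurable φ) {K L : Set G}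
    (Q : Set G) (hK : IsCompact K) (hL : IsCompact L) :
    ∫⁻ y in K, ∫⁻ z in Kᶜ * Q, φ (y⁻¹ * z) ∂μ ∂μ ≤
      μ (K * (L ∪ closure Q) ∩ (Kᶜ * (L ∪ closure Q))) * ∫⁻ x, φ x ∂μ +
        μ K * ∫⁻ x in Lᶜ, φ x ∂μ := by
  -- The Følner condition has the same compact set in both factors: `L` is needed in the first,
  -- `closure Q` in the second.
  set E := K * (L ∪ closure Q) ∩ (Kᶜ * (L ∪ closure Q)) with hE
  have hEm : MeasurableSet (Kᶜ * Q) := hK.isClosed.isOpen_compl.mul_right.measurableSet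
  have hLm : MeasurableSet Lᶜ := hL.isClosed.measurableSet.compl
  have hE' : MeasurableSet (K * L ∩ (Kᶜ * Q)) :=
    (hK.mul hL).isClosed.measurableSet.inter hEm
  have hsub : K * L ∩ (Kᶜ * Q) ⊆ E :=
    Set.inter_subset_inter (Set.mul_subset_mul_left Set.subset_union_left)
      (Set.mul_subset_mul_left (subset_closure.trans Set.subset_union_right))
  have hinner : ∀ y ∈ K, ∫⁻ z in Kᶜ * Q, φ (y⁻¹ * z) ∂μ ≤
      ∫⁻ z in E, φ (y⁻¹ * z) ∂μ + ∫⁻ z, Lᶜ.indicator φ (y⁻¹ * z) ∂μ := by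
    intro y hy
    have hmeas : Measurable fun z => Lᶜ.indicator φ (y⁻¹ * z) :=
      (hφ.indicator hLm).comp (measurable_const_mul _)
    calc ∫⁻ z in Kᶜ * Q, φ (y⁻¹ * z) ∂μ
        = ∫⁻ z, (Kᶜ * Q).indicator (fun z => φ (y⁻¹ * z)) z ∂μ := (lintegral_indicator hEm _).symm
      _ ≤ ∫⁻ z, ((K * L ∩ (Kᶜ * Q)).indicator (fun z => φ (y⁻¹ * z)) z +
            Lᶜ.indicator φ (y⁻¹ * z)) ∂μ := by
          refine lintegral_mono fun z => ?_
          by_cases hz : z ∈ Kᶜ * Q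
          · by_cases hzL : y⁻¹ * z ∈ L
            · have : z ∈ K * L := ⟨y, hy, y⁻¹ * z, hzL, mul_inv_cancel_left y z⟩
              rw [Set.indicator_of_mem hz, Set.indicator_of_mem (s := K * L ∩ (Kᶜ * Q))
                ⟨this, hz⟩]
              exact le_self_add
            · rw [Set.indicator_of_mem hz, Set.indicator_of_mem (s := Lᶜ) hzL]
              exact le_add_self
          · rw [Set.indicator_of_notMem hz]
            exact zero_le
      _ = ∫⁻ z in K * L ∩ (Kᶜ * Q), φ (y⁻¹ * z) ∂μ + ∫⁻ z, Lᶜ.indicator φ (y⁻¹ * z) ∂μ := by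
          rw [lintegral_add_right _ hmeas, lintegral_indicator hE']
      _ ≤ _ := by gcongr
  calc _ ≤ ∫⁻ y in K, (∫⁻ z in E, φ (y⁻¹ * z) ∂μ + ∫⁻ z, Lᶜ.indicator φ (y⁻¹ * z) ∂μ) ∂μ :=
        setLIntegral_mono' hK.isClosed.measurableSet hinner
    _ = ∫⁻ y in K, ∫⁻ z in E, φ (y⁻¹ * z) ∂μ ∂μ + μ K * ∫⁻ x in Lᶜ, φ x ∂μ := by
        simp_rw [lintegral_mul_left_eq_self (μ := μ) (Lᶜ.indicator φ)]
        rw [lintegral_add_right _ measurable_const, setLIntegral_const, mul_comm,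
          lintegral_indicator hLm]
    _ ≤ _ := by
        gcongr
        exact lintegral_lintegral_inv_mul_le' hφ K E

/-- A finite integral has small tails outside compact sets. -/
lemma exists_isCompact_lintegral_compl_le [LocallyCompactSpace G] [T2Space G] {φ : G → ℝ≥0∞}
    (hfinite : ∫⁻ x, φ x ∂μ < ∞) {ε : ℝ≥0∞} (hε : 0 < ε) :
    ∃ L : Set G, IsCompact L ∧ ∫⁻ x in Lᶜ, φ x ∂μ ≤ ε := by
  have hanti : Antitone fun n => (compactCovering G n)ᶜ := fun m n hmn =>
    Set.compl_subset_compl.2 (compactCovering_subset G hmn)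
  have hm : ∀ n, MeasurableSet (compactCovering G n)ᶜ := fun n =>
    (isCompact_compactCovering G n).isClosed.measurableSet.compl
  have ht := tendsto_measure_iInter_atTop (μ := μ.withDensity φ) (fun n => (hm n).nullMeasurableSet)
    hanti ⟨0, by
      rw [withDensity_apply _ (hm 0)]
      exact ((setLIntegral_le_lintegral _ _).trans_lt hfinite).ne⟩
  rw [← Set.compl_iUnion, iUnion_compactCovering, Set.compl_univ, measure_empty] at ht
  obtain ⟨n, hn⟩ := (ht.eventually (ge_mem_nhds hε)).exists
  refine ⟨compactCovering G n, isCompact_compactCovering G n, ?_⟩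
  rw [← withDensity_apply _ (hm n)]
  exact hn

/-- `L` is fixed first so that the tail costs at most `c / 2`; the Følner condition for `L ∪ closure
Q` makes the boundary part as small for large `n`. -/
theorem isLittleO_lintegral_lintegral_inv_mul [LocallyCompactSpace G] [T2Space G]
    [μ.IsHaarMeasure] [μ.IsMulRightInvariant] [μ.IsInvInvariant] {φ : G → ℝ≥0∞}
    (hφ : Measurable φ) (hfinite : ∫⁻ x, φ x ∂μ < ∞) {Q : Set G} (hQ : IsCompact (closure Q))
    {K : ℕ → Set G} (hK : IsStrongFolner μ K) :
    (fun n => (∫⁻ y in K n, ∫⁻ z in (K n)ᶜ * Q, φ (y⁻¹ * z) ∂μ ∂μ).toReal) =o[atTop]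
      (fun n => μ.real (K n)) := by
  rw [isLittleO_iff]
  intro c hc
  have hc2 : 0 < ENNReal.ofReal (c / 2) := ENNReal.ofReal_pos.2 (half_pos hc)
  obtain ⟨L, hL, htail⟩ := exists_isCompact_lintegral_compl_le hfinite hc2
  have ht := ENNReal.Tendsto.mul_const (hK.tendsto (L ∪ closure Q) (hL.union hQ))
    (Or.inr hfinite.ne) (b := ∫⁻ x, φ x ∂μ)
  rw [zero_mul] at ht
  filter_upwards [ht.eventually (ge_mem_nhds hc2)] with n hn
  have hKfin : μ (K n) ≠ ∞ := (hK.isCompact n).measure_lt_top.ne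
  have hK0 := hK.nonnull n
  have hle : ∫⁻ y in K n, ∫⁻ z in (K n)ᶜ * Q, φ (y⁻¹ * z) ∂μ ∂μ ≤
      ENNReal.ofReal c * μ (K n) := by
    refine (lintegral_lintegral_inv_mul_le_add hφ Q (hK.isCompact n) hL).trans ?_
    set b := μ (K n * (L ∪ closure Q) ∩ ((K n)ᶜ * (L ∪ closure Q)))
    have h1 : b * ∫⁻ x, φ x ∂μ = μ (K n) * (b / μ (K n) * ∫⁻ x, φ x ∂μ) := by
      rw [← mul_assoc, ENNReal.mul_div_cancel hK0 hKfin]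
    calc _ ≤ μ (K n) * ENNReal.ofReal (c / 2) + μ (K n) * ENNReal.ofReal (c / 2) := by
          rw [h1]
          gcongr
      _ = _ := by
          rw [← mul_add, ← ENNReal.ofReal_add (by positivity) (by positivity), add_halves,
            mul_comm]
  rw [Real.norm_of_nonneg ENNReal.toReal_nonneg, Real.norm_of_nonneg measureReal_nonneg]
  have := ENNReal.toReal_mono (ENNReal.mul_ne_top ENNReal.ofReal_ne_top hKfin) hle
  rwa [ENNReal.toReal_mul, ENNReal.toReal_ofReal hc.le] at this

end ErrorTerm

namespace ProjectiveRep

/-! ### Translation invariance and relative separation -/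

section Counting

variable {G H : Type*} [Group G] [TopologicalSpace G] [MeasurableSpace G]
  [NormedAddCommGroup H] [InnerProductSpace ℂ H] {π : ProjectiveRep G H}

/-- Frames of the form `π(Λ) g` are invariant under left translation of `Λ`. -/
lemma IsFrameWithBounds.smul {Λ : Set G} {g : H} {A B : ℝ} (h : π.IsFrameWithBounds Λ g A B)
    (x : G) : π.IsFrameWithBounds (x • Λ) g A B := by
  refine ⟨h.1, h.2.1, fun f => ?_⟩
  have h1 : ∑' l : (x • Λ : Set G), ‖π.coeff g f l‖ₑ ^ 2 =
      ∑' l : Λ, ‖π.coeff g ((π.op x).symm f) l‖ₑ ^ 2 := by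
    have h2 : ∑' l : (fun l => x * l) '' Λ, ‖π.coeff g f l‖ₑ ^ 2 =
        ∑' l : Λ, ‖π.coeff g f (x * l)‖ₑ ^ 2 :=
      tsum_image (fun l => ‖π.coeff g f l‖ₑ ^ 2) (mul_right_injective x).injOn
    refine Eq.trans h2 (tsum_congr fun l => ?_)
    rw [← ofReal_norm, norm_coeff_mul_left, ofReal_norm]
  have h3 := h.2.2 ((π.op x).symm f)
  rw [LinearIsometryEquiv.norm_map] at h3
  rwa [h1]

lemma IsFrameWithBounds.ne_zero [Nontrivial H] {Λ : Set G} {g : H} {A B : ℝ}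
    (h : π.IsFrameWithBounds Λ g A B) : g ≠ 0 := by
  rintro rfl
  obtain ⟨f, hf⟩ := exists_ne (0 : H)
  have h1 := (h.2.2 f).1
  simp only [coeff, map_zero, inner_zero_left, enorm_zero, ne_eq, OfNat.ofNat_ne_zero,
    not_false_eq_true, zero_pow, tsum_zero, nonpos_iff_eq_zero, ENNReal.ofReal_eq_zero] at h1
  have := h.1
  have : 0 < A * ‖f‖ ^ 2 := by have := norm_pos_iff.2 hf; positivity
  linarith

variable [IsTopologicalGroup G] [LocallyCompactSpace G] [SecondCountableTopology G] [T2Space G]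
  [BorelSpace G] [TopologicalSpace.SeparableSpace H]

/-- The index set of a frame `π(Λ) g` is relatively separated, with a bound that depends only on
`g`, the upper frame bound and the size of the translated compact set. -/
theorem exists_encard_inter_smul_le {g : H} (hg : g ≠ 0) {S : Set G} (hS : IsCompact S) (B : ℝ) :
    ∃ N : ℝ≥0∞, N ≠ ∞ ∧ ∀ (A : ℝ) (Λ : Set G), π.IsFrameWithBounds Λ g A B →
      ∀ z : G, ((Λ ∩ z • S).encard : ℝ≥0∞) ≤ N := by
  have hg' : 0 < ‖g‖ := norm_pos_iff.2 hg
  set c : ℝ≥0∞ := ENNReal.ofReal (‖g‖ ^ 2 / 2) ^ 2 with hc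
  have hc0 : c ≠ 0 := by
    have : 0 < ENNReal.ofReal (‖g‖ ^ 2 / 2) := ENNReal.ofReal_pos.2 (by positivity)
    positivity
  have hct : c ≠ ∞ := by simp [hc]
  -- Each point of `Λ ∩ y • U` adds at least `c` to the frame sum of `π(y) g`, which is at most `B
  -- ‖g‖²`.
  let U : Set G := {x | ‖g‖ ^ 2 / 2 < ‖π.coeff g g x‖}
  have hU : U ∈ 𝓝 (1 : G) := by
    refine (isOpen_lt continuous_const (π.continuous_norm_coeff g g)).mem_nhds ?_
    rw [Set.mem_ofPred_eq, norm_coeff_self_one]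
    exact half_lt_self (by positivity)
  set M : ℝ≥0∞ := ENNReal.ofReal (B * ‖g‖ ^ 2) / c with hM
  have hMt : M ≠ ∞ := ENNReal.div_ne_top ENNReal.ofReal_ne_top hc0
  obtain ⟨t, ht⟩ := hS.exists_finset_subset_biUnion_smul hU
  refine ⟨t.card * M, ENNReal.mul_ne_top (ENNReal.natCast_ne_top _) hMt, fun A Λ hΛ z => ?_⟩
  have hloc : ∀ y : G, ((Λ ∩ y • U).encard : ℝ≥0∞) ≤ M := by
    intro y
    rw [hM, ENNReal.le_div_iff_mul_le (Or.inl hc0) (Or.inl hct), ← ENNReal.tsum_set_const]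
    have hup := (hΛ.2.2 (π.op y g)).2
    rw [LinearIsometryEquiv.norm_map] at hup
    refine le_trans ?_ hup
    refine le_trans ?_ (ENNReal.tsum_mono_subtype (fun l => ‖π.coeff g (π.op y g) l‖ₑ ^ 2)
      (Set.inter_subset_left (s := Λ) (t := y • U)))
    refine ENNReal.tsum_le_tsum fun l => ?_
    have hl : y⁻¹ * (l : G) ∈ U := Set.mem_smul_set_iff_inv_smul_mem.1 l.2.2
    rw [hc, ← ofReal_norm (π.coeff g (π.op y g) l), norm_coeff_op_left]
    gcongr
    exact hl.le
  calc ((Λ ∩ z • S).encard : ℝ≥0∞) = ∑' _ : (Λ ∩ z • S : Set G), (1 : ℝ≥0∞) :=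
        (ENNReal.tsum_set_one _).symm
    _ ≤ ∑' _ : (⋃ x ∈ t, Λ ∩ (z * x) • U : Set G), (1 : ℝ≥0∞) := by
        refine ENNReal.tsum_mono_subtype (fun _ => 1) ?_
        rintro l ⟨hl, hlS⟩
        obtain ⟨s, hs, rfl⟩ := hlS
        obtain ⟨x, hx, hsx⟩ := Set.mem_iUnion₂.1 (ht hs)
        refine Set.mem_iUnion₂.2 ⟨x, hx, hl, ?_⟩
        rw [mul_smul]
        exact Set.smul_mem_smul_set hsx
    _ ≤ ∑ x ∈ t, ∑' _ : (Λ ∩ (z * x) • U : Set G), (1 : ℝ≥0∞) :=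
        ENNReal.tsum_biUnion_le (fun _ => 1) t _
    _ ≤ ∑ x ∈ t, M := by
        refine Finset.sum_le_sum fun x _ => ?_
        rw [ENNReal.tsum_set_one]
        exact hloc _
    _ = t.card * M := by rw [Finset.sum_const, nsmul_eq_mul]

lemma IsFrameWithBounds.finite_inter [Nontrivial H] {Λ : Set G} {g : H} {A B : ℝ}
    (h : π.IsFrameWithBounds Λ g A B) {S : Set G} (hS : IsCompact S) : (Λ ∩ S).Finite := by
  obtain ⟨N, hN, hle⟩ := exists_encard_inter_smul_le h.ne_zero hS B
  have h1 := hle A Λ h 1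
  rw [one_smul] at h1
  rw [← Set.encard_lt_top_iff, ← ENat.toENNReal_lt, ENat.toENNReal_top]
  exact h1.trans_lt hN.lt_top

end Counting

end ProjectiveRep

/-! ### From sums over `Λ` to integrals -/

section Sampling

variable {G : Type*} [Group G] [TopologicalSpace G] [IsTopologicalGroup G] [MeasurableSpace G]
  [BorelSpace G] {μ : Measure G}

open Classical in
/-- Sums over a relatively separated set are controlled by integrals of the local maximal
function. -/
theorem measure_interior_mul_tsum_le [μ.IsMulLeftInvariant] {F : G → ℂ}
    (hF : Continuous fun x => ‖F x‖ₑ) {Q : Set G} (hQ : Q⁻¹ = Q) {Λ K : Set G} (hK : IsClosed K)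
    {N : ℝ≥0∞} (hN : ∀ z : G, ((Λ ∩ z • Q).encard : ℝ≥0∞) ≤ N) (y : G) :
    μ (interior Q) * ∑' l : Λ, (if (l : G) ∈ K then 0 else ‖F (y⁻¹ * l)‖ₑ ^ 2) ≤
      N * ∫⁻ z in Kᶜ * Q, localMax Q F (y⁻¹ * z) ^ 2 ∂μ := by
  rw [ENNReal.tsum_eq_iSup_sum, ENNReal.mul_iSup]
  refine iSup_le fun s => ?_
  have hinv : ∀ {q}, q ∈ Q → q⁻¹ ∈ Q := fun hq => by rwa [← Set.mem_inv, hQ]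
  have hEm : MeasurableSet (Kᶜ * Q) := hK.isOpen_compl.mul_right.measurableSet
  have hUm : ∀ l : G, MeasurableSet (l • interior Q) := fun l =>
    (isOpen_interior.smul l).measurableSet
  set ψ : G → ℝ≥0∞ := (Kᶜ * Q).indicator fun z => localMax Q F (y⁻¹ * z) ^ 2 with hψ
  have hψm : Measurable ψ :=
    Measurable.indicator (((measurable_localMax hF Q).comp (measurable_const_mul _)).pow_const 2)
      hEm
  -- If `z = l q` with `q ∈ Q`, then `l = z q⁻¹` with `q⁻¹ ∈ Q`, so `|F(y⁻¹ l)| ≤ M_Q F(y⁻¹ z)`.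
  have hterm : ∀ l : Λ, μ (interior Q) * (if (l : G) ∈ K then 0 else ‖F (y⁻¹ * l)‖ₑ ^ 2) ≤
      ∫⁻ z, ((l : G) • interior Q).indicator ψ z ∂μ := by
    intro l
    split_ifs with hl
    · simp
    · rw [lintegral_indicator (hUm l), ← measure_smul μ (l : G) (interior Q), mul_comm,
        ← setLIntegral_const]
      refine setLIntegral_mono' (hUm l) fun z hz => ?_
      obtain ⟨q, hq, rfl⟩ := hz
      have hqQ := interior_subset hq
      have hmem : (l : G) * q ∈ Kᶜ * Q := Set.mul_mem_mul hl hqQ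
      change _ ≤ ψ ((l : G) * q)
      rw [hψ, Set.indicator_of_mem hmem]
      gcongr
      have := enorm_le_localMax (F := F) (y⁻¹ * (l * q)) (hinv hqQ)
      rwa [← mul_assoc, mul_inv_cancel_right, mul_assoc] at this
  -- By symmetry of `Q`, `z ∈ l • interior Q` forces `l ∈ z • Q`, so at most `N` translates overlap
  -- at `z`.
  have hcount : ∀ z, ∑ l ∈ s, ((l : G) • interior Q).indicator ψ z ≤ N * ψ z := by
    intro z
    simp_rw [Set.indicator_apply]
    rw [← Finset.sum_filter, Finset.sum_const, nsmul_eq_mul]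
    gcongr
    refine le_trans ?_ (hN z)
    rw [← ENat.toENNReal_coe, ENat.toENNReal_le, ← Set.encard_coe_eq_coe_finsetCard,
      ← Function.Injective.encard_image Subtype.val_injective]
    refine Set.encard_le_encard ?_
    rintro _ ⟨l, hl, rfl⟩
    refine ⟨l.2, ?_⟩
    obtain ⟨q, hq, hz⟩ := (Finset.mem_filter.1 (Finset.mem_coe.1 hl)).2
    refine ⟨q⁻¹, hinv (interior_subset hq), ?_⟩
    rw [← hz]
    exact mul_inv_cancel_right _ _
  calc μ (interior Q) * ∑ l ∈ s, (if (l : G) ∈ K then 0 else ‖F (y⁻¹ * l)‖ₑ ^ 2)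
      ≤ ∑ l ∈ s, ∫⁻ z, ((l : G) • interior Q).indicator ψ z ∂μ := by
        rw [Finset.mul_sum]
        exact Finset.sum_le_sum fun l _ => hterm l
    _ = ∫⁻ z, ∑ l ∈ s, ((l : G) • interior Q).indicator ψ z ∂μ :=
        (lintegral_finsetSum _ fun (l : Λ) _ => hψm.indicator (hUm l)).symm
    _ ≤ ∫⁻ z, N * ψ z ∂μ := lintegral_mono hcount
    _ = _ := by rw [lintegral_const_mul _ hψm, hψ, lintegral_indicator hEm]

end Sampling

/-! ### Assembling the estimate -/

namespace ProjectiveRep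

variable {G H : Type*} [Group G] [TopologicalSpace G] [IsTopologicalGroup G]
  [LocallyCompactSpace G] [T2Space G] [SecondCountableTopology G] [MeasurableSpace G]
  [BorelSpace G] [NormedAddCommGroup H] [InnerProductSpace ℂ H]
  [TopologicalSpace.SeparableSpace H] {π : ProjectiveRep G H} {μ : Measure G}

/-- In the constant, `A⁻¹` comes from the approximation, `N / μ(interior Q)` from the sampling bound
and `‖g‖²` from the final division. -/
theorem IsFrameWithBounds.le_ncard_inter [CompleteSpace H] [μ.IsHaarMeasure] {d : ℝ}
    (hd : π.IsFormalDegree μ d) {Λ : Set G} {g : H} (hg : g ≠ 0) {A B : ℝ}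
    (hΛ : π.IsFrameWithBounds Λ g A B) {Q : Set G} (hQ : IsRelCompactSymmUnitNhd Q) {N : ℝ≥0∞}
    (hN : N ≠ ∞) (hΛN : ∀ z : G, ((Λ ∩ z • Q).encard : ℝ≥0∞) ≤ N) {K : Set G}
    (hK : IsCompact K) (hfin : (Λ ∩ K).Finite) (hI : π.errorTerm μ Q g K ≠ ∞) :
    d * (μ.real K - A⁻¹ * N.toReal / (μ.real (interior Q) * ‖g‖ ^ 2) *
      (π.errorTerm μ Q g K).toReal) ≤ (Λ ∩ K).ncard := by
  classical
  obtain ⟨hQ1, hQs, hQc⟩ := hQ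
  have hA : 0 < A := hΛ.1
  have hdpos : 0 < d := hd.1
  have hg' : 0 < ‖g‖ := norm_pos_iff.2 hg
  have hU0 : μ (interior Q) ≠ 0 :=
    isOpen_interior.measure_ne_zero μ ⟨1, mem_interior_iff_mem_nhds.2 hQ1⟩
  have hUt : μ (interior Q) ≠ ∞ :=
    ((measure_mono (interior_subset.trans subset_closure)).trans_lt hQc.measure_lt_top).ne
  have hq : N / μ (interior Q) ≠ ∞ := ENNReal.div_ne_top hN hU0
  have hsum : ∫⁻ y in K, ∑' l : Λ, (if (l : G) ∈ K then 0 else ‖π.coeff g g (y⁻¹ * l)‖ₑ ^ 2) ∂μ ≤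
      N / μ (interior Q) * π.errorTerm μ Q g K := by
    rw [errorTerm, ← lintegral_const_mul' _ _ hq]
    refine lintegral_mono fun y => ?_
    have := measure_interior_mul_tsum_le (μ := μ) (π.continuous_enorm_coeff g g) hQs hK.isClosed
      hΛN y
    rw [mul_comm, ← ENNReal.le_div_iff_mul_le (Or.inl hU0) (Or.inl hUt)] at this
    rwa [ENNReal.mul_div_right_comm] at this
  have hmain := (hΛ.measure_mul_norm_sq_le hd hfin).trans
    (add_le_add_right (mul_le_mul_right hsum _) _)
  have hfin1 : ((Λ ∩ K).ncard : ℝ≥0∞) * ENNReal.ofReal (d⁻¹ * ‖g‖ ^ 2) ≠ ∞ :=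
    ENNReal.mul_ne_top (ENNReal.natCast_ne_top _) ENNReal.ofReal_ne_top
  have hfin2 : ENNReal.ofReal A⁻¹ * (N / μ (interior Q) * π.errorTerm μ Q g K) ≠ ∞ :=
    ENNReal.mul_ne_top ENNReal.ofReal_ne_top (ENNReal.mul_ne_top hq hI)
  have hreal := ENNReal.toReal_mono (ENNReal.add_ne_top.2 ⟨hfin1, hfin2⟩) hmain
  rw [ENNReal.toReal_add hfin1 hfin2] at hreal
  simp only [ENNReal.toReal_mul, ENNReal.toReal_div, ENNReal.toReal_natCast] at hreal
  rw [ENNReal.toReal_ofReal (by positivity), ENNReal.toReal_ofReal (by positivity),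
    ENNReal.toReal_ofReal (by positivity)] at hreal
  have hU : 0 < μ.real (interior Q) := ENNReal.toReal_pos hU0 hUt
  change μ.real K * ‖g‖ ^ 2 ≤ _ * (d⁻¹ * ‖g‖ ^ 2) +
    A⁻¹ * (N.toReal / μ.real (interior Q) * (π.errorTerm μ Q g K).toReal) at hreal
  set I := (π.errorTerm μ Q g K).toReal
  set n : ℝ := ((Λ ∩ K).ncard : ℝ)
  have hkey : μ.real K ≤ n * d⁻¹ + A⁻¹ * N.toReal / (μ.real (interior Q) * ‖g‖ ^ 2) * I := by
    refine le_of_mul_le_mul_right (hreal.trans_eq ?_) (pow_pos hg' 2)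
    field_simp
  calc d * (μ.real K - A⁻¹ * N.toReal / (μ.real (interior Q) * ‖g‖ ^ 2) * I)
      ≤ d * (n * d⁻¹) := by gcongr; linarith
    _ = n := by field_simp

lemma errorTerm_ne_top [μ.IsHaarMeasure] [μ.IsMulRightInvariant] {g : H}
    (hg : g ∈ π.localizedVectors μ) {Q : Set G} (hQ : IsRelCompactSymmUnitNhd Q) {K : Set G}
    (hK : IsCompact K) : π.errorTerm μ Q g K ≠ ∞ := by
  obtain ⟨Q₀, hQ₀, hfinite⟩ := hg
  exact ((lintegral_lintegral_inv_mul_le K (Kᶜ * Q)).trans_lt (ENNReal.mul_lt_top hK.measure_lt_top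
    (lintegral_localMax_sq_lt_top (π.continuous_enorm_coeff g g) hQ₀.1 hQ.2.2 hfinite))).ne

end ProjectiveRep

theorem theorem3p3 {G H : Type*}
    [Group G] [TopologicalSpace G] [IsTopologicalGroup G] [LocallyCompactSpace G] [T2Space G]
    [SecondCountableTopology G] [MeasurableSpace G] [BorelSpace G]
    (μ : Measure G) [μ.IsHaarMeasure] [μ.IsMulRightInvariant]
    [NormedAddCommGroup H] [InnerProductSpace ℂ H] [CompleteSpace H]
    [TopologicalSpace.SeparableSpace H]
    (π : ProjectiveRep G H) (hπ : π.IsDiscreteSeries μ) :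
    (∃! d : ℝ, π.IsFormalDegree μ d) ∧
    ∀ d : ℝ, π.IsFormalDegree μ d →
    ∀ g ∈ π.localizedVectors μ, ∀ Q : Set G, IsRelCompactSymmUnitNhd Q → ∀ A B : ℝ,
      ∃ C : ℝ, 0 < C ∧
        ∀ Λ : Set G, π.IsFrameWithBounds Λ g A B →
        ∀ K : ℕ → Set G, IsStrongFolnerExhaustion μ K →
          (∀ n, π.errorTerm μ Q g (K n) ≠ ∞) ∧
          (∀ (n : ℕ) (x : G), (Λ ∩ x • K n).Finite) ∧
          (∀ n, d * (μ.real (K n) - C * (π.errorTerm μ Q g (K n)).toReal) ≤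
            ⨅ x : G, ((Λ ∩ x • K n).ncard : ℝ)) ∧
          (fun n => (π.errorTerm μ Q g (K n)).toReal) =o[atTop] (fun n => μ.real (K n)) := by
  have hinv : μ.IsInvInvariant :=
    Measure.IsHaarMeasure.isInvInvariant_of_isMulRightInvariant μ
  have hnt : Nontrivial H := by
    obtain ⟨-, h, hh, -⟩ := hπ
    exact ⟨h, 0, hh⟩
  obtain ⟨d₀, hd₀⟩ := hπ.exists_isFormalDegree
  refine ⟨⟨d₀, hd₀, fun d hd => hd.unique hd₀⟩, fun d hd g hgD Q hQ A B => ?_⟩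
  by_cases hg : g = 0
  · exact ⟨1, one_pos, fun Λ hΛ => absurd hg hΛ.ne_zero⟩
  obtain ⟨N, hN, hcount⟩ := ProjectiveRep.exists_encard_inter_smul_le (π := π) hg hQ.2.2 B
  set C := A⁻¹ * N.toReal / (μ.real (interior Q) * ‖g‖ ^ 2)
  -- `C` itself need not be positive: `A` is arbitrary here and `N` may be zero.
  refine ⟨max C 1, lt_max_of_lt_right one_pos, fun Λ hΛ K hK =>
    ⟨fun n => ProjectiveRep.errorTerm_ne_top hgD hQ (hK.isCompact n),
      fun n x => hΛ.finite_inter ((hK.isCompact n).smul x), fun n => le_ciInf fun x => ?_, ?_⟩⟩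
  · have hI := ProjectiveRep.errorTerm_ne_top hgD hQ (hK.isCompact n)
    have hΛx := hΛ.smul x⁻¹
    have hle := hΛx.le_ncard_inter hd hg hQ hN
      (fun z => (ENat.toENNReal_le.2 (Set.encard_le_encard (Set.inter_subset_inter_right _
        (Set.smul_set_mono subset_closure)))).trans (hcount A _ hΛx z))
      (hK.isCompact n) (hΛx.finite_inter (hK.isCompact n)) hI
    -- Translating `Λ` instead of `K n` keeps the error term independent of `x`.
    have hset : x⁻¹ • Λ ∩ K n = x⁻¹ • (Λ ∩ x • K n) := by
      rw [Set.smul_set_inter, inv_smul_smul]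
    rw [hset, Set.ncard_smul_set] at hle
    refine le_trans ?_ hle
    have hdpos := hd.1
    gcongr
    exact le_max_left _ _
  · obtain ⟨Q₀, hQ₀, hfinite⟩ := hgD
    have hF := π.continuous_enorm_coeff g g
    exact isLittleO_lintegral_lintegral_inv_mul (φ := fun x => localMax Q (π.coeff g g) x ^ 2)
      ((measurable_localMax hF Q).pow_const 2)
      (lintegral_localMax_sq_lt_top hF hQ₀.1 hQ.2.2 hfinite) hQ.2.2 hK.toIsStrongFolner
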